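/- Let $n\ge 1$ and $\rho=[n,n-1,\dots,1]$. We consider six families of six-vertex models on bent grids. Label the top rows $1,\dots,p$ from top to bottom and the bottom rows $\overline p,\dots,\overline 1$; the right ends of rows $j$ and $\overline j$ are joined by a bend carrying a vertex. Here $p=n$, except that $p=n-1$ in family $\mathfrak{BC}$. For $\lambda=[\lambda_1>\dots>\lambda_n\ge 1]$ the full columns are labelled $\lambda_1,\dots,1$ from left to right (in family $\mathfrak D$: $\lambda_1,\dots,2$). The families $\mathfrak B_*,\mathfrak C$ have an extra central row, labelled $0$, and $\mathfrak{BC}$ has a central row labelled $n$. The families $\mathfrak C,\mathfrak C_*,\mathfrak D$ have an extra half column, to the right of the full columns, crossing only the rows $\overline p,\dots,\overline 1$ (labelled $0$ in $\mathfrak C,\mathfrak C_*$ and $1$ in $\mathfrak D$). An admissible state orients all edges so that the in-degree equals the out-degree at every vertex, all left boundary edges point inward, all bottom boundary edges point outward, and the top edge of a full column points outward if its label is a part of $\lambda$ and inward otherwise. The right edge of the central row points outward in $\mathfrak B_*$ and inward in $\mathfrak{BC}$; in $\mathfrak C$ it is joined by a corner vertex to the top of the half column. The top edge of the half column points inward in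 $\mathfrak C_*$; in $\mathfrak D$ it points outward if $1$ is a part of $\lambda$ and inward otherwise. A tetravalent vertex in row $j$ has weight $a_1^{(j)},a_2^{(j)},b_1^{(j)},b_2^{(j)},c_1^{(j)},c_2^{(j)}$ according as its inward arrows are on the edges NW, SE, SW, NE, NS, EW. The weights satisfy $c_2^{(j)}=1$, $c_1^{(j)}=a_1^{(j)}a_2^{(j)}+b_1^{(j)}b_2^{(j)}$, and the symmetry conditions $a_1^{(\overline j)}=a_2^{(j)}$, $a_2^{(\overline j)}=a_1^{(j)}$, $b_1^{(\overline j)}=b_2^{(j)}$, $b_2^{(\overline j)}=b_1^{(j)}$, $c_1^{(\overline j)}=c_1^{(j)}$, $c_2^{(\overline j)}=c_2^{(j)}$. In a central row with label $s$ ($s=0$, or $s=n$ for $\mathfrak{BC}$) they are $a_1=a_2=a^{(s)}$, $b_1=b_2=b^{(s)}$, $c_2=1$, $c_1=(a^{(s)})^2+(b^{(s)})^2$. A bend whose arrows run from row $j$ to row $\overline j$ has weight $D^{(j)}=i$ in $\mathfrak B,\mathfrak C$ and $D^{(j)}=1$ in the other families; with the opposite orientation its weight is $1$. The corner vertex of $\mathfrak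 C$ has weight $1$ if the arrows run from row $0$ into the half column, and $a^{(0)}-i\,b^{(0)}$ otherwise. Let $\mathcal Z(\mathfrak M^\lambda)$ be the sum, over all admissible states, of the product of the weights of all vertices. Then in the polynomial ring over $\mathbb Z[i]$ in the independent indeterminates $a_1^{(j)},a_2^{(j)},b_1^{(j)},b_2^{(j)}$ and $a^{(s)},b^{(s)}$, writing $$P_m=\prod_{1\le j<k\le m}\left(a_1^{(k)}a_2^{(j)}+b_1^{(j)}b_2^{(k)}\right)\left(a_2^{(j)}a_2^{(k)}+b_1^{(k)}b_1^{(j)}\right),$$ we have \begin{align*} \mathcal Z(\mathfrak B^\rho)&=P_n\,\prod_{j\le n}\left(a_2^{(j)}+i\,b_1^{(j)}\right),\\ \mathcal Z(\mathfrak B_*^\rho)&=P_n\,\prod_{j\le n}\left(a^{(0)}a_2^{(j)}+b_1^{(j)}b^{(0)}\right),\\ \mathcal Z(\mathfrak C^\rho)&=P_n\,\prod_{j\le n}\left(a_2^{(j)}+i\,b_1^{(j)}\right)\left(a^{(0)}a_2^{(j)}+b_1^{(j)}b^{(0)}\right),\\ \mathcal Z(\mathfrak C_*^\rho)&=P_n\,\prod_{j\le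 n}\left(\bigl(a_2^{(j)}\bigr)^2+\bigl(b_1^{(j)}\bigr)^2\right),\\ \mathcal Z(\mathfrak D^\rho)&=P_n,\\ \mathcal Z(\mathfrak{BC}^\rho)&=P_{n-1}\,\prod_{j<n}\left(a^{(n)}a_2^{(j)}+b_1^{(j)}b^{(n)}\right)\left(\bigl(a_2^{(j)}\bigr)^2+\bigl(b_1^{(j)}\bigr)^2\right). \end{align*} In particular, each $\mathcal Z(\mathfrak M^\rho)$ is a product of homogeneous polynomials of degree $1$ or $2$ in the Boltzmann weights. -/

import Mathlib

/-- The six families of bent ice models. -/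
inductive IceFamily
  | B
  | BStar
  | C
  | CStar
  | D
  | BC

namespace IceFamily

/-- Number of pairs of rows `j`, `j̄` joined by a u-turn bend, for a partition with `n` parts. -/
def bends : IceFamily → ℕ → ℕ
  | BC, n => n - 1
  | _, n => n

/-- Number of central rows (`0` or `1`). -/
def central : IceFamily → ℕ
  | BStar => 1
  | C => 1
  | BC => 1
  | _ => 0

/-- Number of half columns to the right of the full columns (`0` or `1`). The half column passes
through the barred rows only. -/
def half : IceFamily → ℕ
  | C => 1
  | CStar => 1
  | D => 1
  | _ => 0

/-- Spectral index of the central row (if there is one). -/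
def star : IceFamily → ℕ → ℕ
  | BC, n => n
  | _, _ => 0

/-- Label of the rightmost full column; in family `D` the label `1` is given to the half column. -/
def firstLabel : IceFamily → ℕ
  | D => 2
  | _ => 1

/-- Number of full columns: the full columns are labelled from `λ₁` (leftmost, the largest part)
down to `firstLabel`. -/
def fullCols {n : ℕ} (M : IceFamily) (lam : Fin n → ℕ) : ℕ :=
  Finset.univ.sup lam + 1 - M.firstLabel

/-- Label of the `k`-th full column, counted from the left starting with `k = 0`. -/
def colLabel {n : ℕ} (lam : Fin n → ℕ) (k : ℕ) : ℕ :=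
  Finset.univ.sup lam - k

end IceFamily

/-- The arrows on the four edges at a tetravalent vertex. A horizontal edge carries `true` if its
arrow points right, a vertical edge carries `true` if its arrow points down. -/
structure VertexConfig where
  west : Bool
  north : Bool
  east : Bool
  south : Bool

namespace VertexConfig

/-- Two arrows point towards the vertex (hence two point away from it). -/
def IsIce (v : VertexConfig) : Prop :=
  v.west.toNat + v.north.toNat + (!v.east).toNat + (!v.south).toNat = 2

instance (v : VertexConfig) : Decidable v.IsIce := by
  unfold IsIce; infer_instance

end VertexConfig

/-- Boltzmann weights of the six decorations of a vertex. -/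
structure SixVertexWeights (R : Type*) where
  a₁ : R
  a₂ : R
  b₁ : R
  b₂ : R
  c₁ : R
  c₂ : R

/-- The weight of a vertex: `a₁ = NW`, `a₂ = SE`, `b₁ = SW`, `b₂ = NE`, `c₁ = NS`, `c₂ = EW`, where
the letters name the two edges whose arrows point inward. -/
def SixVertexWeights.weight {R : Type*} [Zero R] (w : SixVertexWeights R) : VertexConfig → R
  | ⟨true, true, true, true⟩ => w.a₁
  | ⟨false, false, false, false⟩ => w.a₂
  | ⟨true, false, true, false⟩ => w.b₁
  | ⟨false, true, false, true⟩ => w.b₂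
  | ⟨false, true, true, false⟩ => w.c₁
  | ⟨true, false, false, true⟩ => w.c₂
  | _ => 0

/-- The free Boltzmann weights: `a₁, a₂, b₁, b₂` for the spectral indices `j = 1, 2, …` of the bent
rows, and `a, b` for the spectral index of the central row. -/
structure BoltzmannWeights (R : Type*) where
  a₁ : ℕ → R
  a₂ : ℕ → R
  b₁ : ℕ → R
  b₂ : ℕ → R
  a : ℕ → R
  b : ℕ → R

namespace BoltzmannWeights

variable {R : Type*} [CommRing R]

/-- Weights in row `j`, with `c₂ = 1` and the free-fermion condition `a₁a₂ + b₁b₂ = c₁c₂`. -/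
def row (w : BoltzmannWeights R) (j : ℕ) : SixVertexWeights R where
  a₁ := w.a₁ j
  a₂ := w.a₂ j
  b₁ := w.b₁ j
  b₂ := w.b₂ j
  c₁ := w.a₁ j * w.a₂ j + w.b₁ j * w.b₂ j
  c₂ := 1

/-- Weights in row `j̄`, given by the symmetry conditions `a₁^(j) = a₂^(j̄)`, `a₁^(j̄) = a₂^(j)`,
`b₁^(j) = b₂^(j̄)`, `b₁^(j̄) = b₂^(j)`, `c₁^(j) = c₁^(j̄)`, `c₂^(j) = c₂^(j̄)`. -/
def barRow (w : BoltzmannWeights R) (j : ℕ) : SixVertexWeights R where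
  a₁ := w.a₂ j
  a₂ := w.a₁ j
  b₁ := w.b₂ j
  b₂ := w.b₁ j
  c₁ := (w.row j).c₁
  c₂ := (w.row j).c₂

/-- Weights in the central row `s = s̄`, where the symmetry conditions give `a₁ = a₂ = a` and
`b₁ = b₂ = b`. -/
def centralRow (w : BoltzmannWeights R) (s : ℕ) : SixVertexWeights R where
  a₁ := w.a s
  a₂ := w.a s
  b₁ := w.b s
  b₂ := w.b s
  c₁ := w.a s ^ 2 + w.b s ^ 2
  c₂ := 1

end BoltzmannWeights

/-- An assignment of arrows to all edges of a bent grid with `p` bent pairs of rows, `c` central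
rows, `N` full columns and `H` half columns. From top to bottom the rows are `1, …, p`, then the
central row, then `p̄, …, 1̄`; the rows `j + 1` and its mirror image have index `j : Fin p`.

* `top j k`, `mid r k`, `bot j k`: the horizontal edge with `k` vertices of its row to its left
  (`true` = right); barred rows also cross the half columns.
* `ver k s`: the edge of the `k`-th full column from the left with `s` rows above it
  (`true` = down).
* `hver h s`: the edge of the half column with `s` barred rows above it (`true` = down). -/
structure IceState (p c N H : ℕ) where
  top : Fin p → Fin (N + 1) → Bool
  mid : Fin c → Fin (N + 1) → Bool
  bot : Fin p → Fin (N + H + 1) → Bool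
  ver : Fin N → Fin (p + c + p + 1) → Bool
  hver : Fin H → Fin (p + 1) → Bool

namespace IceState

variable {p c N H : ℕ}

/-- An assignment is the tuple of its components. -/
def equivProd : IceState p c N H ≃
    (Fin p → Fin (N + 1) → Bool) × (Fin c → Fin (N + 1) → Bool) ×
    (Fin p → Fin (N + H + 1) → Bool) × (Fin N → Fin (p + c + p + 1) → Bool) ×
    (Fin H → Fin (p + 1) → Bool) where
  toFun A := (A.top, A.mid, A.bot, A.ver, A.hver)
  invFun x := ⟨x.1, x.2.1, x.2.2.1, x.2.2.2.1, x.2.2.2.2⟩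
  left_inv _ := rfl
  right_inv _ := rfl

instance : Fintype (IceState p c N H) := Fintype.ofEquiv _ equivProd.symm

/-- The vertex in row `j + 1` and column `k`. -/
def topVertex (A : IceState p c N H) (j : Fin p) (k : Fin N) : VertexConfig where
  west := A.top j k.castSucc
  east := A.top j k.succ
  north := A.ver k ⟨j, by omega⟩
  south := A.ver k ⟨j + 1, by omega⟩

/-- The vertex in the central row and column `k`. -/
def midVertex (A : IceState p c N H) (r : Fin c) (k : Fin N) : VertexConfig where
  west := A.mid r k.castSucc
  east := A.mid r k.succ
  north := A.ver k ⟨p + r, by omega⟩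
  south := A.ver k ⟨p + r + 1, by omega⟩

/-- The vertex in the mirror image of row `j + 1` and the full column `k`; there are
`p + c + (p - 1 - j)` rows above it. -/
def botVertex (A : IceState p c N H) (j : Fin p) (k : Fin N) : VertexConfig where
  west := A.bot j ⟨k, by omega⟩
  east := A.bot j ⟨k + 1, by omega⟩
  north := A.ver k ⟨p + c + (p - 1 - j), by omega⟩
  south := A.ver k ⟨p + c + (p - 1 - j) + 1, by omega⟩

/-- The vertex in the mirror image of row `j + 1` and the half column. -/
def halfVertex (A : IceState p c N H) (j : Fin p) (h : Fin H) : VertexConfig where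
  west := A.bot j ⟨N + h, by omega⟩
  east := A.bot j ⟨N + h + 1, by omega⟩
  north := A.hver h ⟨p - 1 - j, by omega⟩
  south := A.hver h ⟨p - 1 - j + 1, by omega⟩

/-- At every tetravalent vertex, and at the vertex on every bend, the in-degree equals the
out-degree. -/
def Balanced (A : IceState p c N H) : Prop :=
  (∀ j k, (A.topVertex j k).IsIce) ∧ (∀ r k, (A.midVertex r k).IsIce) ∧
  (∀ j k, (A.botVertex j k).IsIce) ∧ (∀ j h, (A.halfVertex j h).IsIce) ∧
  (∀ j, A.bot j (Fin.last _) = !(A.top j (Fin.last N)))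

/-- Boundary conditions common to all families: the left edges of the rows point inward and the
bottom edges of the columns point outward. -/
def LeftBottom (A : IceState p c N H) : Prop :=
  (∀ j, A.top j 0 = true) ∧ (∀ r, A.mid r 0 = true) ∧ (∀ j, A.bot j 0 = true) ∧
  (∀ k, A.ver k (Fin.last _) = true) ∧ (∀ h, A.hver h (Fin.last _) = true)

/-- Conditions at the right end of the central row and at the top of the half column: in `B_*` the
right edge of the central row points outward, in `BC` it points inward, in `C` the central row is
joined to the half column by a corner vertex with one arrow in and one arrow out, in `C_*` the top
edge of the half column points inward, and in `D` it points outward exactly when `1` is a part. -/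
def RightEnd {n : ℕ} (M : IceFamily) (lam : Fin n → ℕ) (A : IceState p c N H) : Prop :=
  match M with
  | .B => True
  | .BStar => ∀ r, A.mid r (Fin.last N) = true
  | .C => ∀ r h, A.mid r (Fin.last N) = A.hver h 0
  | .CStar => ∀ h, A.hver h 0 = true
  | .D => ∀ h, A.hver h 0 = false ↔ ∃ t, lam t = 1
  | .BC => ∀ r, A.mid r (Fin.last N) = false

/-- The top edge of a full column points outward exactly when its label is a part of `λ`. -/
def TopBoundary {n : ℕ} (lam : Fin n → ℕ) (A : IceState p c N H) : Prop :=
  ∀ k : Fin N, A.ver k 0 = false ↔ ∃ t, lam t = IceFamily.colLabel lam k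

/-- The admissible states. -/
def Admissible {n : ℕ} (M : IceFamily) (lam : Fin n → ℕ) (A : IceState p c N H) : Prop :=
  A.Balanced ∧ A.LeftBottom ∧ A.RightEnd M lam ∧ A.TopBoundary lam

instance {n : ℕ} (M : IceFamily) (lam : Fin n → ℕ) (A : IceState p c N H) :
    Decidable (A.Admissible M lam) := by
  unfold Admissible Balanced LeftBottom RightEnd TopBoundary
  cases M <;> infer_instance

end IceState

section Weights

variable {R : Type*} [CommRing R]

/-- The bend weight `D^(j)` (arrow entering the bend from row `j`, leaving into row `j̄`), where `I`
is the imaginary unit; the other bend weight is `U^(j) = 1`. -/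
def bendD (I : R) : IceFamily → R
  | .B => I
  | .C => I
  | _ => 1

/-- The weight of the bend joining row `j + 1` to its mirror image. -/
def bendWeight {p c N H : ℕ} (I : R) (M : IceFamily) (A : IceState p c N H) (j : Fin p) : R :=
  if A.top j (Fin.last N) = true then bendD I M else 1

/-- The weight of the corner vertex at the end of row `0` in family `C`: `R = 1` if the arrows run
from the row into the half column, and `L = a^(0) - i b^(0)` otherwise. -/
def cornerWeight {p c N H : ℕ} (I : R) (w : BoltzmannWeights R) (M : IceFamily)
    (A : IceState p c N H) : R :=
  match M with
  | .C => ∏ r : Fin c, if A.mid r (Fin.last N) = true then 1 else w.a 0 - I * w.b 0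
  | _ => 1

/-- The Boltzmann weight of a state: the product of the weights of all its vertices. -/
def stateWeight {p c N H : ℕ} (I : R) (w : BoltzmannWeights R) (M : IceFamily) (s : ℕ)
    (A : IceState p c N H) : R :=
  (∏ j : Fin p, ∏ k : Fin N, (w.row (j + 1)).weight (A.topVertex j k)) *
  (∏ r : Fin c, ∏ k : Fin N, (w.centralRow s).weight (A.midVertex r k)) *
  (∏ j : Fin p, ∏ k : Fin N, (w.barRow (j + 1)).weight (A.botVertex j k)) *
  (∏ j : Fin p, ∏ h : Fin H, (w.barRow (j + 1)).weight (A.halfVertex j h)) *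
  (∏ j : Fin p, bendWeight I M A j) * cornerWeight I w M A

/-- The partition function `Z(M^λ)` for `λ = [λ₁, …, λₙ]`, `λ₁ > ⋯ > λₙ ≥ 1`, with the given
Boltzmann weights and bend weights. -/
def partitionFunction {n : ℕ} (I : R) (w : BoltzmannWeights R) (M : IceFamily)
    (lam : Fin n → ℕ) : R :=
  ∑ A : IceState (M.bends n) M.central (M.fullCols lam) M.half with A.Admissible M lam,
    stateWeight I w M (M.star n) A

end Weights

/-- `ρ = [n, n - 1, …, 1]`. -/
def rho (n : ℕ) : Fin n → ℕ := fun j => n - j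

/-- Names of the indeterminates. -/
inductive WeightVar
  | a₁ (j : ℕ)
  | a₂ (j : ℕ)
  | b₁ (j : ℕ)
  | b₂ (j : ℕ)
  | a (j : ℕ)
  | b (j : ℕ)

/-- The ring `ℤ[i][a₁^(j), a₂^(j), b₁^(j), b₂^(j), a^(j), b^(j)]`. -/
abbrev WeightRing : Type := MvPolynomial WeightVar GaussianInt

noncomputable section

/-- The Boltzmann weights as independent indeterminates. -/
def gen : BoltzmannWeights WeightRing where
  a₁ j := MvPolynomial.X (.a₁ j)
  a₂ j := MvPolynomial.X (.a₂ j)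
  b₁ j := MvPolynomial.X (.b₁ j)
  b₂ j := MvPolynomial.X (.b₂ j)
  a j := MvPolynomial.X (.a j)
  b j := MvPolynomial.X (.b j)

/-- The imaginary unit as a constant polynomial. -/
def imUnit : WeightRing := MvPolynomial.C (⟨0, 1⟩ : GaussianInt)

/-- `Z(M^λ)` as a polynomial in the Boltzmann weights. -/
def genericZ {n : ℕ} (M : IceFamily) (lam : Fin n → ℕ) : WeightRing :=
  partitionFunction imUnit gen M lam

end

/-!
The partition functions are computed with transfer matrices. A row of `N` vertices with a
right-pointing arrow on its left end is an operator on the arrows of `N` vertical edges: `opA` if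
the arrow on its right end points right, `opB` if it points left. A bent pair of rows with weights
`u` acts on the part `X` of the grid which it encloses by `K_u X = D • A_u X B_ū + B_u X A_ū`
(`bendStep`), where `ū` is the mirror image of `u`, and a bent grid is an iteration of such steps
around its central part (`bentGrid`, `center`, `partitionFunction_rho`).

Write `α(u, v) = a₁(u) a₂(v) + b₁(v) b₂(u)`. Two identities govern the bends.

* Exchange. The free-fermionic Yang--Baxter equation `yangBaxter_row` gives the commutation
  relations of the operators `A` and `B` of two rows. Since `α(v̄, ū) = α(u, v)`, the mixed terms
  cancel and neighbouring bends commute up to a scalar: `α(u, v) K_u K_v = α(v, u) K_v K_u`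
  (`bendStep_swap`).
* Reflection. Exchanging the two rows of the innermost bend through the central part gives
  `Q(a₁, b₂) K_w X = Q(a₂, b₁) K_w̄ X`, where `Q` is a product of linear forms which depends only on the
  family: some (or none) of `a₂ + i b₁`, `a₂ - i b₁`, `a a₂ + b b₁` (`reflects_center`).

Consider the partition function as a function of the weight `b₁` of the outermost row `w`. It is a
polynomial whose degree is less than the number of boundary edges of the columns
(`polyLT_bendStep`). It vanishes at the zeros of `α(v, w)` and `α(v̄, w)` for each inner row `v`,
by moving the bend `v` next to `w`, in the second case after a reflection in the centre; and it
vanishes at the zeros of `Q(a₂, b₁)`, by moving `w` to the centre and reflecting it there. These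
are as many zeros as the degree allows, so the partition function is a multiple of the product of
these linear forms (`PolyLT.eq_formProd`). The factor is found at `b₁ = 0`: there the outermost
bend and the leftmost column admit a single configuration, and what remains is the grid with one
bend and one column less (`bendStep_allUp_allDown_of_b₁_eq_zero`). Induction on the number of bends
gives `bentGrid_center`.

The argument divides by certain expressions in the weights and needs the zeros to be distinct. This
non-degeneracy (`Generic`) holds for the indeterminate weights in the field of fractions of the
polynomial ring, because it holds for one numerical specialisation (`generic_sampleWeights`).
-/

namespace BentIce

open Matrix

/-! ### Rows of free-fermionic weights -/

/-- The four free Boltzmann weights of a row of free-fermionic six-vertex weights. -/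
structure FermionRow (R : Type*) where
  a₁ : R
  a₂ : R
  b₁ : R
  b₂ : R

namespace FermionRow

variable {R : Type*}

/-- The mirror image of a row. -/
def bar (u : FermionRow R) : FermionRow R where
  a₁ := u.a₂
  a₂ := u.a₁
  b₁ := u.b₂
  b₂ := u.b₁

@[simp] lemma bar_bar (u : FermionRow R) : u.bar.bar = u := rfl

variable [CommRing R]

/-- The six weights of a free-fermionic row, normalised by `c₂ = 1`. -/
def weights (u : FermionRow R) : SixVertexWeights R where
  a₁ := u.a₁
  a₂ := u.a₂
  b₁ := u.b₁
  b₂ := u.b₂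
  c₁ := u.a₁ * u.a₂ + u.b₁ * u.b₂
  c₂ := 1

/-- The weight of the `R`-matrix of two rows on a pair of right-pointing arrows. -/
def alpha (u v : FermionRow R) : R := u.a₁ * v.a₂ + v.b₁ * u.b₂

/-- The free-fermionic `R`-matrix of the rows `u`, `v`: the entry from the pair of arrows `x` to the
pair of arrows `p`. -/
def rMatrix (u v : FermionRow R) : Matrix (Bool × Bool) (Bool × Bool) R
  | (true, true), (true, true) => alpha u v
  | (false, false), (false, false) => alpha v u
  | (true, false), (true, false) => u.a₁ * u.a₂ + u.b₁ * u.b₂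
  | (true, false), (false, true) => u.b₂ * v.a₁ - u.a₁ * v.b₂
  | (false, true), (true, false) => u.b₁ * v.a₂ - u.a₂ * v.b₁
  | (false, true), (false, true) => v.a₁ * v.a₂ + v.b₁ * v.b₂
  | _, _ => 0

end FermionRow

/-! ### Row transfer matrices and the Yang--Baxter equation -/

section RowOperators

variable {R : Type*} [CommRing R]

/-- The transfer matrix of a row with `N` vertices: the entry at `s`, `t` is the sum over the inner
horizontal edges with vertical arrows `s` above and `t` below the row, with the arrow `x` on the
left end and `y` on the right end of the row. -/
def rowOp (w : SixVertexWeights R) (N : ℕ) (x y : Bool) :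
    Matrix (Fin N → Bool) (Fin N → Bool) R := fun s t =>
  ∑ e : Fin (N + 1) → Bool, if e 0 = x ∧ e (Fin.last N) = y then
    ∏ k : Fin N, w.weight ⟨e k.castSucc, s k, e k.succ, t k⟩ else 0

lemma rowOp_zero (w : SixVertexWeights R) (x y : Bool) (s t : Fin 0 → Bool) :
    rowOp w 0 x y s t = if x = y then 1 else 0 := by
  unfold rowOp
  rw [← (Equiv.funUnique (Fin 1) Bool).symm.sum_comp]
  cases x <;> cases y <;> simp

/-- Peeling off the leftmost column. -/
lemma rowOp_cons (w : SixVertexWeights R) (N : ℕ) (x y a c : Bool) (s t : Fin N → Bool) :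
    rowOp w (N + 1) x y (Fin.cons a s) (Fin.cons c t) =
      ∑ m, w.weight ⟨x, a, m, c⟩ * rowOp w N m y s t := by
  unfold rowOp
  rw [← (Fin.consEquiv (fun _ => Bool)).sum_comp, Fintype.sum_prod_type,
    Finset.sum_eq_single x]
  · simp only [Finset.mul_sum]
    rw [Finset.sum_comm]
    refine Finset.sum_congr rfl fun e _ => ?_
    rw [Finset.sum_eq_single (e 0)]
    · simp only [Fin.consEquiv, Equiv.coe_fn_mk, Fin.cons_zero, ← Fin.succ_last, Fin.cons_succ,
        true_and, Fin.prod_univ_succ, Fin.castSucc_zero, ← Fin.succ_castSucc]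
      split_ifs <;> simp
    · intro b _ hb
      simp [hb.symm]
    · simp
  · intro b _ hb
    simp [Fin.consEquiv, hb]
  · simp

/-- Peeling off the rightmost column. -/
lemma rowOp_snoc (w : SixVertexWeights R) (N : ℕ) (x y a c : Bool) (s t : Fin N → Bool) :
    rowOp w (N + 1) x y (Fin.snoc s a : Fin (N + 1) → Bool) (Fin.snoc t c : Fin (N + 1) → Bool) =
      ∑ m, rowOp w N x m s t * w.weight ⟨m, a, y, c⟩ := by
  unfold rowOp
  rw [← (Fin.snocEquiv (fun _ => Bool)).sum_comp, Fintype.sum_prod_type,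
    Finset.sum_eq_single y]
  · simp only [Finset.sum_mul]
    rw [Finset.sum_comm]
    refine Finset.sum_congr rfl fun e _ => ?_
    rw [Finset.sum_eq_single (e (Fin.last N))]
    · have h0 : (Fin.snoc e y : Fin (N + 2) → Bool) 0 = e 0 := by
        rw [← Fin.castSucc_zero, Fin.snoc_castSucc (α := fun _ => Bool)]
      simp only [Fin.snocEquiv, Equiv.coe_fn_mk, Fin.snoc_last, h0, and_true,
        Fin.prod_univ_castSucc, Fin.snoc_castSucc, Fin.succ_last]
      have h1 : ∀ k : Fin N, (Fin.snoc e y : Fin (N + 2) → Bool) k.castSucc.succ = e k.succ := by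
        intro k
        rw [← Fin.castSucc_succ, Fin.snoc_castSucc (α := fun _ => Bool)]
      simp only [h1]
      split_ifs <;> simp
    · intro b _ hb
      simp [hb.symm]
    · simp
  · intro b _ hb
    simp [Fin.snocEquiv, hb]
  · simp

/-- The sum over the configurations of `N + 1` vertical edges, split by the leftmost edge. -/
lemma sum_cons {A : Type*} [AddCommMonoid A] {N : ℕ} (f : (Fin (N + 1) → Bool) → A) :
    ∑ s, f s = ∑ a : Bool, ∑ s : Fin N → Bool, f (Fin.cons a s) := by
  rw [← (Fin.consEquiv (fun _ => Bool)).sum_comp, Fintype.sum_prod_type]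
  rfl

/-- The column operator of two vertices on top of each other, as a matrix from the pair of left
arrows to the pair of right arrows. -/
def pairColumn (u v : SixVertexWeights R) (n s : Bool) :
    Matrix (Bool × Bool) (Bool × Bool) R := fun x y =>
  ∑ m, u.weight ⟨x.1, n, y.1, m⟩ * v.weight ⟨x.2, m, y.2, s⟩

/-- Two adjacent rows, as a matrix from the pair of left arrows to the pair of right arrows. -/
def pairRow (u v : SixVertexWeights R) (N : ℕ) (s t : Fin N → Bool) :
    Matrix (Bool × Bool) (Bool × Bool) R := fun x y =>
  (rowOp u N x.1 y.1 * rowOp v N x.2 y.2) s t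

lemma pairRow_cons (u v : SixVertexWeights R) (N : ℕ) (a c : Bool) (s t : Fin N → Bool) :
    pairRow u v (N + 1) (Fin.cons a s) (Fin.cons c t) =
      pairColumn u v a c * pairRow u v N s t := by
  ext x y
  simp only [pairRow, pairColumn, Matrix.mul_apply, sum_cons, rowOp_cons, Fintype.sum_prod_type,
    Fintype.sum_bool, Finset.mul_sum]
  simp only [← Finset.sum_add_distrib]
  exact Finset.sum_congr rfl fun _ _ => by ring

/-- The Yang--Baxter equation for one column. -/
lemma yangBaxter_column (u v : FermionRow R) (n s : Bool) :
    u.rMatrix v * pairColumn u.weights v.weights n s =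
      pairColumn v.weights u.weights n s * u.rMatrix v := by
  ext ⟨x₁, x₂⟩ ⟨y₁, y₂⟩
  simp only [Matrix.mul_apply, Fintype.sum_prod_type, Fintype.sum_bool, pairColumn]
  cases n <;> cases s <;> cases x₁ <;> cases x₂ <;> cases y₁ <;> cases y₂ <;>
    simp [FermionRow.rMatrix, FermionRow.weights, SixVertexWeights.weight, FermionRow.alpha] <;>
    ring

/-- The Yang--Baxter equation for two rows. -/
lemma yangBaxter_row (u v : FermionRow R) (N : ℕ) (s t : Fin N → Bool) :
    u.rMatrix v * pairRow u.weights v.weights N s t =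
      pairRow v.weights u.weights N s t * u.rMatrix v := by
  induction N with
  | zero =>
    have h : ∀ u v : SixVertexWeights R, pairRow u v 0 s t = 1 := by
      intro u v
      ext ⟨x₁, x₂⟩ ⟨y₁, y₂⟩
      simp only [pairRow, Matrix.mul_apply, rowOp_zero, Matrix.one_apply, Prod.mk.injEq]
      simp [← ite_and, and_comm]
    rw [h, h, mul_one, one_mul]
  | succ N ih =>
    rw [← Fin.cons_self_tail s, ← Fin.cons_self_tail t, pairRow_cons, pairRow_cons,
      ← mul_assoc, yangBaxter_column, mul_assoc, ih, mul_assoc]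

end RowOperators

/-! ### Commutation relations of row operators -/

section Exchange

variable {R : Type*} [CommRing R]

/-- The row operator with right-pointing arrows on both ends. -/
def opA (u : FermionRow R) (N : ℕ) : Matrix (Fin N → Bool) (Fin N → Bool) R :=
  rowOp u.weights N true true

/-- The row operator with inward arrows on both ends. -/
def opB (u : FermionRow R) (N : ℕ) : Matrix (Fin N → Bool) (Fin N → Bool) R :=
  rowOp u.weights N true false

variable (u v : FermionRow R) (N : ℕ)

/-- The entries of the Yang--Baxter equation with right-pointing arrows on the left, where the
`R`-matrix acts by the scalar `u.alpha v`. -/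
lemma exchange (y : Bool × Bool) :
    u.alpha v • (rowOp u.weights N true y.1 * rowOp v.weights N true y.2) =
      ∑ p : Bool × Bool, u.rMatrix v p y •
        (rowOp v.weights N true p.1 * rowOp u.weights N true p.2) := by
  ext s t
  have h := congrFun (congrFun (yangBaxter_row u v N s t) (true, true)) y
  simp only [Matrix.mul_apply (M := u.rMatrix v)] at h
  rw [Finset.sum_eq_single (true, true)] at h
  · simp only [Matrix.mul_apply (N := u.rMatrix v)] at h
    simp only [pairRow] at h
    rw [Matrix.smul_apply, smul_eq_mul, Matrix.sum_apply]
    simp only [Matrix.smul_apply, smul_eq_mul]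
    rw [show u.alpha v = u.rMatrix v (true, true) (true, true) from rfl, h]
    exact Finset.sum_congr rfl fun p _ => mul_comm _ _
  · rintro ⟨_ | _, _ | _⟩ _ hb <;> simp_all [FermionRow.rMatrix]
  · simp

lemma exchange_AA : u.alpha v • (opA u N * opA v N) = u.alpha v • (opA v N * opA u N) := by
  simpa [Fintype.sum_prod_type, FermionRow.rMatrix, opA, opB] using exchange u v N (true, true)

lemma exchange_AB : u.alpha v • (opA u N * opB v N) =
    (u.a₁ * u.a₂ + u.b₁ * u.b₂) • (opA v N * opB u N) +
      (u.b₁ * v.a₂ - u.a₂ * v.b₁) • (opB v N * opA u N) := by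
  simpa [Fintype.sum_prod_type, FermionRow.rMatrix, opA, opB] using exchange u v N (true, false)

lemma exchange_BA : u.alpha v • (opB u N * opA v N) =
    (u.b₂ * v.a₁ - u.a₁ * v.b₂) • (opA v N * opB u N) +
      (v.a₁ * v.a₂ + v.b₁ * v.b₂) • (opB v N * opA u N) := by
  simpa [Fintype.sum_prod_type, FermionRow.rMatrix, opA, opB] using exchange u v N (false, true)

lemma exchange_BB : u.alpha v • (opB u N * opB v N) = v.alpha u • (opB v N * opB u N) := by
  simpa [Fintype.sum_prod_type, FermionRow.rMatrix, opA, opB] using exchange u v N (false, false)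

end Exchange

/-! ### Exchange of neighbouring bends -/

section Bends

variable {R : Type*} [CommRing R] {N M : ℕ}

/-- Enclosing the inner part `X` of a bent grid in the row `u`, its mirror image and the bend
joining them, where `D` is the weight of a bend traversed downwards. -/
def bendStep (D : R) (u : FermionRow R) (X : Matrix (Fin N → Bool) (Fin M → Bool) R) :
    Matrix (Fin N → Bool) (Fin M → Bool) R :=
  D • (opA u N * X * opB u.bar M) + opB u N * X * opA u.bar M

lemma bendStep_smul (D : R) (u : FermionRow R) (c : R)
    (X : Matrix (Fin N → Bool) (Fin M → Bool) R) :
    bendStep D u (c • X) = c • bendStep D u X := by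
  simp only [bendStep, Matrix.mul_smul, Matrix.smul_mul, smul_add, smul_comm c D]

/-- Neighbouring bends commute up to a scalar. The rows above the inner part and their mirror images
below it are exchanged with the same scalar `u.alpha v`, and then the mixed terms cancel. -/
lemma bendStep_swap_sq (D : R) (u v : FermionRow R)
    (X : Matrix (Fin N → Bool) (Fin M → Bool) R) :
    (u.alpha v * u.alpha v) • bendStep D u (bendStep D v X) =
      (u.alpha v * v.alpha u) • bendStep D v (bendStep D u X) := by
  have key : ∀ P P' : Matrix (Fin N → Bool) (Fin N → Bool) R,
      ∀ Q Q' : Matrix (Fin M → Bool) (Fin M → Bool) R,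
      u.alpha v • P = P' → u.alpha v • Q = Q' →
      (u.alpha v * u.alpha v) • (P * X * Q) = P' * X * Q' := by
    rintro P P' Q Q' rfl rfl
    simp only [Matrix.mul_smul, Matrix.smul_mul, smul_smul]
  have hα : v.bar.alpha u.bar = u.alpha v := by simp only [FermionRow.alpha, FermionRow.bar]; ring
  have hα' : u.bar.alpha v.bar = v.alpha u := by simp only [FermionRow.alpha, FermionRow.bar]; ring
  have aa := exchange_AA v.bar u.bar M
  have ab := exchange_AB v.bar u.bar M
  have ba := exchange_BA v.bar u.bar M
  have bb := exchange_BB v.bar u.bar M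
  rw [hα] at aa ab ba bb
  rw [hα'] at bb
  -- the coefficients of `D * D`, `D` (twice) and `1` in the product of two bends
  have h₁ := key _ _ _ _ (exchange_AA u v N) bb
  have h₂ := key _ _ _ _ (exchange_AB u v N) ab
  have h₃ := key _ _ _ _ (exchange_BA u v N) ba
  have h₄ := key _ _ _ _ (exchange_BB u v N) aa
  simp only [FermionRow.bar] at *
  simp only [bendStep, FermionRow.bar, Matrix.mul_add, Matrix.add_mul, Matrix.mul_smul,
    Matrix.smul_mul, Matrix.mul_assoc, smul_add, smul_smul] at h₁ h₂ h₃ h₄ ⊢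
  simp only [FermionRow.alpha] at h₁ h₂ h₃ h₄ ⊢
  linear_combination (norm := skip) (D * D) • h₁ + D • h₂ + D • h₃ + h₄
  match_scalars <;> ring

end Bends

/-! ### Exchange of three rows -/

section ThreeRows

variable {R : Type*} [CommRing R]

/-- Reversing the order of three adjacent rows with right-pointing arrows on the left. -/
lemma exchange_three (u v w : FermionRow R) (N : ℕ) (y₁ y₂ y₃ : Bool) :
    (u.alpha v * u.alpha w * v.alpha w) •
      (rowOp u.weights N true y₁ * (rowOp v.weights N true y₂ * rowOp w.weights N true y₃)) =
    ∑ q : Bool × Bool, ∑ r : Bool × Bool, ∑ p : Bool × Bool,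
      (v.rMatrix w q (y₂, y₃) * u.rMatrix w r (y₁, q.1) * u.rMatrix v p (r.2, q.2)) •
        (rowOp w.weights N true r.1 *
          (rowOp v.weights N true p.1 * rowOp u.weights N true p.2)) := by
  rw [mul_smul, ← Matrix.mul_smul, exchange v w N (y₂, y₃), Matrix.mul_sum, Finset.smul_sum]
  refine Finset.sum_congr rfl fun q _ => ?_
  rw [Matrix.mul_smul, ← Matrix.mul_assoc, smul_smul,
    show u.alpha v * u.alpha w * v.rMatrix w q (y₂, y₃) =
      v.rMatrix w q (y₂, y₃) * (u.alpha v * u.alpha w) by ring, mul_smul, mul_smul,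
    ← Matrix.smul_mul, exchange u w N (y₁, q.1), Matrix.sum_mul, Finset.smul_sum, Finset.smul_sum]
  refine Finset.sum_congr rfl fun r _ => ?_
  trans (v.rMatrix w q (y₂, y₃) * u.rMatrix w r (y₁, q.1)) • (rowOp w.weights N true r.1 *
    (u.alpha v • (rowOp u.weights N true r.2 * rowOp v.weights N true q.2)))
  · simp only [Matrix.smul_mul, Matrix.mul_smul, Matrix.mul_assoc, smul_smul]
    congr 1
    ring
  · rw [exchange u v N (r.2, q.2)]
    simp only [Matrix.mul_sum, Matrix.mul_smul, Finset.smul_sum, smul_smul]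

end ThreeRows

/-! ### The half column -/

section HalfColumn

variable {R : Type*} [CommRing R]

/-- Appending a half column on the right, whose top edge carries the arrow `x`. -/
def halfTop (R : Type*) [CommRing R] (N : ℕ) (x : Bool) :
    Matrix (Fin N → Bool) (Fin (N + 1) → Bool) R := fun s t =>
  if t = Fin.snoc (α := fun _ => Bool) s x then 1 else 0

lemma mul_halfTop_snoc {N : ℕ} (P : Matrix (Fin N → Bool) (Fin N → Bool) R) (x c : Bool)
    (s t : Fin N → Bool) :
    (P * halfTop R N x) s (Fin.snoc t c : Fin (N + 1) → Bool) = if c = x then P s t else 0 := by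
  rw [Matrix.mul_apply, Finset.sum_eq_single t]
  · simp [halfTop, Fin.snoc_inj]
  · intro b _ hb
    simp [halfTop, Fin.snoc_inj, hb.symm]
  · simp

/-- The vertex on the half column splits off from a row. -/
lemma halfTop_mul_rowOp (w : SixVertexWeights R) (N : ℕ) (p x y : Bool) :
    halfTop R N x * rowOp w (N + 1) p y = ∑ m : Bool, ∑ z : Bool,
      w.weight ⟨m, x, y, z⟩ • (rowOp w N p m * halfTop R N z) := by
  ext s t
  obtain ⟨t, c, rfl⟩ : ∃ (t' : Fin N → Bool) (c : Bool), t = Fin.snoc t' c :=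
    ⟨_, _, (Fin.snoc_init_self t).symm⟩
  rw [Matrix.mul_apply, Finset.sum_eq_single (Fin.snoc s x : Fin (N + 1) → Bool)]
  · simp only [Matrix.sum_apply, Matrix.smul_apply, smul_eq_mul, rowOp_snoc, mul_halfTop_snoc]
    simp [halfTop, mul_comm]
  · intro b _ hb
    simp [halfTop, hb]
  · simp

lemma halfTop_true_opA (u : FermionRow R) (N : ℕ) :
    halfTop R N true * opA u (N + 1) =
      u.a₁ • (opA u N * halfTop R N true) +
        (u.a₁ * u.a₂ + u.b₁ * u.b₂) • (opB u N * halfTop R N false) := by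
  simp [opA, opB, halfTop_mul_rowOp, SixVertexWeights.weight, FermionRow.weights]

lemma halfTop_true_opB (u : FermionRow R) (N : ℕ) :
    halfTop R N true * opB u (N + 1) = u.b₂ • (opB u N * halfTop R N true) := by
  simp [opB, halfTop_mul_rowOp, SixVertexWeights.weight, FermionRow.weights]

lemma halfTop_false_opA (u : FermionRow R) (N : ℕ) :
    halfTop R N false * opA u (N + 1) = u.b₁ • (opA u N * halfTop R N false) := by
  simp [opA, halfTop_mul_rowOp, SixVertexWeights.weight, FermionRow.weights]

lemma halfTop_false_opB (u : FermionRow R) (N : ℕ) :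
    halfTop R N false * opB u (N + 1) =
      opA u N * halfTop R N true + u.a₂ • (opB u N * halfTop R N false) := by
  simp [opA, opB, halfTop_mul_rowOp, SixVertexWeights.weight, FermionRow.weights]

end HalfColumn

/-! ### Reflection of the innermost bend -/

section Fish

variable {R : Type*} [CommRing R]

/-- The central row, which is its own mirror image. -/
def centralFermion (a b : R) : FermionRow R := ⟨a, a, b, b⟩

/-- Reflection of an innermost bend with nothing inside. The bend weight `I` makes both terms of the
exchanged bend proportional to those of its mirror image. -/
lemma fish_one (I : R) (hI : I * I = -1) (w : FermionRow R) (N : ℕ) :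
    w.alpha w.bar • (w.a₁ + I * w.b₂) • bendStep I w (1 : Matrix (Fin N → Bool) (Fin N → Bool) R) =
      w.alpha w.bar • (w.a₂ + I * w.b₁) • bendStep I w.bar 1 := by
  have h₁ := exchange_AB w w.bar N
  have h₂ := exchange_BA w w.bar N
  simp only [bendStep, mul_one, FermionRow.bar_bar]
  simp only [FermionRow.alpha, FermionRow.bar] at h₁ h₂ ⊢
  linear_combination (norm := skip) ((w.a₁ + I * w.b₂) * I) • h₁ + (w.a₁ + I * w.b₂) • h₂
  match_scalars <;> grind

/-- Reflection around a central row with a right-pointing arrow on its right end. The order of the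
upper row, the central row and the lower row is reversed by `exchange_three`; the first factor on
both sides is the scalar of this exchange. -/
lemma fish_opA (a b : R) (w : FermionRow R) (N : ℕ) :
    (w.alpha (centralFermion a b) * w.alpha w.bar * (centralFermion a b).alpha w.bar) •
      (a * w.a₁ + b * w.b₂) • bendStep 1 w (opA (centralFermion a b) N) =
    (w.alpha (centralFermion a b) * w.alpha w.bar * (centralFermion a b).alpha w.bar) •
      (a * w.a₂ + b * w.b₁) • bendStep 1 w.bar (opA (centralFermion a b) N) := by
  have h₁ := exchange_three w (centralFermion a b) w.bar N true true false
  have h₂ := exchange_three w (centralFermion a b) w.bar N false true true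
  simp only [bendStep, opA, opB, FermionRow.bar_bar, Matrix.mul_assoc]
  simp [Fintype.sum_prod_type, FermionRow.rMatrix, -smul_add, -mul_eq_mul_left_iff] at h₁ h₂
  simp only [FermionRow.alpha, FermionRow.bar, centralFermion] at h₁ h₂ ⊢
  linear_combination (norm := skip) (a * w.a₁ + b * w.b₂) • h₁ + (a * w.a₁ + b * w.b₂) • h₂
  match_scalars <;> ring

/-- Reflection around a central row with a left-pointing arrow on its right end. -/
lemma fish_opB (a b : R) (w : FermionRow R) (N : ℕ) :
    (w.alpha (centralFermion a b) * w.alpha w.bar * (centralFermion a b).alpha w.bar) •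
      ((a * w.a₁ + b * w.b₂) * (w.a₁ ^ 2 + w.b₂ ^ 2)) •
        bendStep 1 w (opB (centralFermion a b) N) =
    (w.alpha (centralFermion a b) * w.alpha w.bar * (centralFermion a b).alpha w.bar) •
      ((a * w.a₂ + b * w.b₁) * (w.a₂ ^ 2 + w.b₁ ^ 2)) •
        bendStep 1 w.bar (opB (centralFermion a b) N) := by
  have h₁ := exchange_three w (centralFermion a b) w.bar N true false false
  have h₂ := exchange_three w (centralFermion a b) w.bar N false false true
  simp only [bendStep, opA, opB, FermionRow.bar_bar, Matrix.mul_assoc]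
  simp [Fintype.sum_prod_type, FermionRow.rMatrix, -smul_add, -mul_eq_mul_left_iff] at h₁ h₂
  simp only [FermionRow.alpha, FermionRow.bar, centralFermion] at h₁ h₂ ⊢
  linear_combination (norm := skip)
    ((a * w.a₁ + b * w.b₂) * (w.a₁ ^ 2 + w.b₂ ^ 2)) • h₁ +
    ((a * w.a₁ + b * w.b₂) * (w.a₁ ^ 2 + w.b₂ ^ 2)) • h₂
  match_scalars <;> ring

/-- Reflection around the top edge of a half column with a downward arrow. The vertex where the
lower row meets the half column is split off before the two rows are exchanged. -/
lemma fish_halfTop_true (w : FermionRow R) (N : ℕ) :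
    w.alpha w.bar • (w.a₁ ^ 2 + w.b₂ ^ 2) • bendStep 1 w (halfTop R N true) =
      w.alpha w.bar • (w.a₂ ^ 2 + w.b₁ ^ 2) • bendStep 1 w.bar (halfTop R N true) := by
  have h₁ := congrArg (· * halfTop R N true) (exchange_AB w w.bar N)
  have h₂ := congrArg (· * halfTop R N true) (exchange_BA w w.bar N)
  have h₃ := congrArg (· * halfTop R N false) (exchange_BB w w.bar N)
  simp only [bendStep, FermionRow.bar_bar, Matrix.mul_assoc, halfTop_true_opA, halfTop_true_opB,
    Matrix.mul_add, Matrix.add_mul, Matrix.mul_smul, Matrix.smul_mul] at h₁ h₂ h₃ ⊢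
  simp only [FermionRow.alpha, FermionRow.bar] at h₁ h₂ h₃ ⊢
  linear_combination (norm := skip)
    (w.a₁ ^ 2 + w.b₂ ^ 2) • w.b₁ • h₁ + (w.a₁ ^ 2 + w.b₂ ^ 2) • w.a₂ • h₂ +
      (w.a₁ ^ 2 + w.b₂ ^ 2) • (w.a₁ * w.a₂ + w.b₁ * w.b₂) • h₃
  match_scalars <;> ring

/-- Reflection around the top edge of a half column with an upward arrow: no factor arises. -/
lemma fish_halfTop_false (w : FermionRow R) (N : ℕ) :
    w.alpha w.bar • bendStep 1 w (halfTop R N false) =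
      w.alpha w.bar • bendStep 1 w.bar (halfTop R N false) := by
  have h₁ := congrArg (· * halfTop R N false) (exchange_AB w w.bar N)
  have h₂ := congrArg (· * halfTop R N false) (exchange_BA w w.bar N)
  have h₃ := congrArg (· * halfTop R N true) (exchange_AA w w.bar N)
  simp only [bendStep, FermionRow.bar_bar, Matrix.mul_assoc, halfTop_false_opA, halfTop_false_opB,
    Matrix.mul_add, Matrix.add_mul, Matrix.mul_smul, Matrix.smul_mul] at h₁ h₂ h₃ ⊢
  simp only [FermionRow.alpha, FermionRow.bar] at h₁ h₂ h₃ ⊢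
  linear_combination (norm := skip) w.a₁ • h₁ + w.b₂ • h₂ + h₃
  match_scalars <;> ring

/-- The central row of family `C`, joined by the corner vertex to the top of the half column. -/
def cornerCenter (I a b : R) (N : ℕ) : Matrix (Fin N → Bool) (Fin (N + 1) → Bool) R :=
  opA (centralFermion a b) N * halfTop R N true +
    (a - I * b) • (opB (centralFermion a b) N * halfTop R N false)

set_option maxHeartbeats 1000000 in
/-- Reflection around a central row joined to the half column. After the vertices on the half column
have been split off, `exchange_three` applies to the terms with either arrow at the bottom of the
half column; the weight `a - I * b` of the corner vertex is what makes them fit together. -/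
lemma fish_cornerCenter (I : R) (hI : I * I = -1) (a b : R) (w : FermionRow R) (N : ℕ) :
    ((a * w.a₁ + b * w.b₂) * (w.a₁ - I * w.b₂)) •
      ((w.a₁ + I * w.b₂) * (a * w.a₁ + b * w.b₂)) • bendStep I w (cornerCenter I a b N) =
    ((a * w.a₁ + b * w.b₂) * (w.a₁ - I * w.b₂)) •
      ((w.a₂ + I * w.b₁) * (a * w.a₂ + b * w.b₁)) •
        bendStep I w.bar (cornerCenter I a b N) := by
  have h := exchange_three w (centralFermion a b) w.bar N
  have h₁ := congrArg (· * halfTop R N true) (h true true false)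
  have h₂ := congrArg (· * halfTop R N true) (h true false true)
  have h₃ := congrArg (· * halfTop R N true) (h false true true)
  have h₄ := congrArg (· * halfTop R N false) (h true false false)
  have h₅ := congrArg (· * halfTop R N false) (h false true false)
  have h₆ := congrArg (· * halfTop R N false) (h false false true)
  simp only [bendStep, cornerCenter, FermionRow.bar_bar, Matrix.mul_assoc, halfTop_false_opA,
    halfTop_false_opB, halfTop_true_opA, halfTop_true_opB,
    Matrix.mul_add, Matrix.add_mul, Matrix.mul_smul, Matrix.smul_mul]
  simp [Fintype.sum_prod_type, FermionRow.rMatrix, -smul_add, -mul_eq_mul_left_iff,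
    Matrix.add_mul, Matrix.mul_assoc] at h₁ h₂ h₃ h₄ h₅ h₆
  simp only [FermionRow.alpha, FermionRow.bar, centralFermion, opA, opB] at h₁ h₂ h₃ h₄ h₅ h₆ ⊢
  linear_combination (norm := skip)
    (I * w.b₁) • h₁ + (I * (a - I * b)) • h₂ + w.a₂ • h₃ + (I * (a - I * b) * w.a₁) • h₄ +
      (w.a₁ * w.a₂ + w.b₁ * w.b₂) • h₅ + ((a - I * b) * w.b₂) • h₆
  match_scalars
  all_goals
    clear h h₁ h₂ h₃ h₄ h₅ h₆
    generalize w.a₁ = x, w.a₂ = y, w.b₁ = z, w.b₂ = t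
    clear w
    grind

end Fish

/-! ### Zeros of the partition function of a bent grid -/

section Vanishing

/-- The value at `(a, b)` of the linear form with coefficients `q`. -/
def linForm {R : Type*} [CommRing R] (q : R × R) (a b : R) : R := q.1 * a + q.2 * b

/-- The product of the values at `(a, b)` of the linear forms with coefficients in `Q`. -/
def formProd {R : Type*} [CommRing R] (Q : List (R × R)) (a b : R) : R :=
  (Q.map fun q => linForm q a b).prod

variable {K : Type*} [Field K] {N M : ℕ}

lemma bendStep_swap (D : K) (u v : FermionRow K) (h : u.alpha v ≠ 0)
    (X : Matrix (Fin N → Bool) (Fin M → Bool) K) :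
    u.alpha v • bendStep D u (bendStep D v X) = v.alpha u • bendStep D v (bendStep D u X) := by
  have key := bendStep_swap_sq D u v X
  rw [mul_smul, mul_smul] at key
  exact smul_right_injective _ h key

/-- The bent grid with the bent rows `l`, listed from the outermost to the innermost one, around the
inner part `X`. -/
def bentGrid (D : K) (l : List (FermionRow K)) (X : Matrix (Fin N → Bool) (Fin M → Bool) K) :
    Matrix (Fin N → Bool) (Fin M → Bool) K :=
  l.foldr (bendStep D) X

lemma bentGrid_cons (D : K) (u : FermionRow K) (l : List (FermionRow K))
    (X : Matrix (Fin N → Bool) (Fin M → Bool) K) :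
    bentGrid D (u :: l) X = bendStep D u (bentGrid D l X) := rfl

lemma bentGrid_append (D : K) (l l' : List (FermionRow K))
    (X : Matrix (Fin N → Bool) (Fin M → Bool) K) :
    bentGrid D (l ++ l') X = bentGrid D l (bentGrid D l' X) := by
  simp [bentGrid]

lemma bentGrid_smul (D : K) (l : List (FermionRow K)) (c : K)
    (X : Matrix (Fin N → Bool) (Fin M → Bool) K) :
    bentGrid D l (c • X) = c • bentGrid D l X := by
  induction l with
  | nil => rfl
  | cons u l ih => rw [bentGrid_cons, bentGrid_cons, ih, bendStep_smul]

/-- An inner bend may be moved to the outside, up to a scalar. -/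
lemma bentGrid_move_front (D : K) (l : List (FermionRow K)) (v : FermionRow K)
    (h : ∀ u ∈ l, u.alpha v ≠ 0) (X : Matrix (Fin N → Bool) (Fin M → Bool) K) :
    ∃ c : K, bentGrid D l (bendStep D v X) = c • bendStep D v (bentGrid D l X) := by
  induction l with
  | nil => exact ⟨1, by simp [bentGrid]⟩
  | cons u l ih =>
    obtain ⟨c, hc⟩ := ih fun x hx => h x (List.mem_cons_of_mem _ hx)
    have hu := h u List.mem_cons_self
    refine ⟨c * ((u.alpha v)⁻¹ * v.alpha u), ?_⟩
    rw [bentGrid_cons, hc, bendStep_smul, bentGrid_cons, mul_smul, mul_smul,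
      ← bendStep_swap D u v hu, inv_smul_smul₀ hu]

/-- The outermost bend may be moved to the inside, up to a scalar. -/
lemma bentGrid_move_back (D : K) (l : List (FermionRow K)) (v : FermionRow K)
    (h : ∀ u ∈ l, v.alpha u ≠ 0) (X : Matrix (Fin N → Bool) (Fin M → Bool) K) :
    ∃ c : K, bendStep D v (bentGrid D l X) = c • bentGrid D l (bendStep D v X) := by
  induction l with
  | nil => exact ⟨1, by simp [bentGrid]⟩
  | cons u l ih =>
    obtain ⟨c, hc⟩ := ih fun x hx => h x (List.mem_cons_of_mem _ hx)
    have hu := h u List.mem_cons_self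
    refine ⟨(v.alpha u)⁻¹ * (u.alpha v * c), ?_⟩
    rw [bentGrid_cons, bentGrid_cons, mul_smul, mul_smul, ← bendStep_smul, ← hc,
      ← bendStep_swap D v u hu, inv_smul_smul₀ hu]

/-- The inner part of a bent grid on which the innermost bend can be reflected: `D` is the weight of
a bend traversed downwards, and the reflection multiplies by a ratio of products of the linear
forms `Q` as soon as the linear forms `S` do not vanish at the weights `a₁`, `b₂` of the row. -/
structure Reflects (D : K) (X : Matrix (Fin N → Bool) (Fin M → Bool) K) (Q S : List (K × K)) :
    Prop where
  sublist : Q.Sublist S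
  reflect : ∀ w : FermionRow K, (∀ q ∈ S, linForm q w.a₁ w.b₂ ≠ 0) →
    formProd Q w.a₁ w.b₂ • bendStep D w X = formProd Q w.a₂ w.b₁ • bendStep D w.bar X

lemma formProd_eq_zero_iff {Q : List (K × K)} {a b : K} :
    formProd Q a b = 0 ↔ ∃ q ∈ Q, linForm q a b = 0 := by
  simp [formProd, List.prod_eq_zero_iff]

variable {D : K} {X : Matrix (Fin N → Bool) (Fin M → Bool) K} {Q S : List (K × K)}

lemma Reflects.formProd_ne_zero (hX : Reflects D X Q S) {w : FermionRow K}
    (hw : ∀ q ∈ S, linForm q w.a₁ w.b₂ ≠ 0) : formProd Q w.a₁ w.b₂ ≠ 0 := by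
  rw [Ne, formProd_eq_zero_iff]
  rintro ⟨q, hq, h⟩
  exact hw q (hX.sublist.subset hq) h

/-- The outermost bend is moved to the centre, where its reflection has weight zero. -/
lemma bentGrid_eq_zero_of_linForm (hX : Reflects D X Q S) {w : FermionRow K}
    {l : List (FermionRow K)} (hw : ∀ q ∈ S, linForm q w.a₁ w.b₂ ≠ 0)
    (hl : ∀ u ∈ l, w.alpha u ≠ 0) (h0 : ∃ q ∈ Q, linForm q w.a₂ w.b₁ = 0) :
    bentGrid D (w :: l) X = 0 := by
  obtain ⟨c, hc⟩ := bentGrid_move_back D l w hl X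
  have hr := hX.reflect w hw
  rw [formProd_eq_zero_iff.2 h0, zero_smul] at hr
  have hz : bendStep D w X = (0 : K) • X := by
    rw [zero_smul]
    exact (smul_eq_zero.1 hr).resolve_left (hX.formProd_ne_zero hw)
  rw [bentGrid_cons, hc, hz, bentGrid_smul, zero_smul, smul_zero]

lemma bentGrid_eq_zero_of_swap {w v : FermionRow K} (l : List (FermionRow K))
    (X : Matrix (Fin N → Bool) (Fin M → Bool) K) (hw : w.alpha v ≠ 0) (h0 : v.alpha w = 0) :
    bentGrid D (w :: v :: l) X = 0 := by
  have h := bendStep_swap D w v hw (bentGrid D l X)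
  rw [h0, zero_smul] at h
  exact (smul_eq_zero.1 h).resolve_left hw

/-- The bend `v` is moved next to the outermost bend `w`, and the exchange of the two gives zero. -/
lemma bentGrid_eq_zero_of_alpha {w v : FermionRow K} {l l' : List (FermionRow K)}
    (hl : ∀ u ∈ l, u.alpha v ≠ 0) (hw : w.alpha v ≠ 0) (h0 : v.alpha w = 0) :
    bentGrid D (w :: (l ++ v :: l')) X = 0 := by
  obtain ⟨c, hc⟩ := bentGrid_move_front D l v hl (bentGrid D l' X)
  rw [bentGrid_cons, bentGrid_append, bentGrid_cons, hc, bendStep_smul, ← bentGrid_append]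
  rw [show bendStep D w (bendStep D v (bentGrid D (l ++ l') X)) = bentGrid D (w :: v :: (l ++ l')) X
    from rfl, bentGrid_eq_zero_of_swap _ _ hw h0, smul_zero]

/-- The bend `v` is moved to the centre and reflected there; its mirror image is then moved next to
the outermost bend `w`. -/
lemma bentGrid_eq_zero_of_alpha_bar (hX : Reflects D X Q S) {w v : FermionRow K}
    {l l' : List (FermionRow K)} (hv : ∀ q ∈ S, linForm q v.a₁ v.b₂ ≠ 0)
    (hl : ∀ u ∈ l ++ l', u.alpha v.bar ≠ 0) (hl' : ∀ u ∈ l', v.alpha u ≠ 0)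
    (hw : w.alpha v.bar ≠ 0) (h0 : v.bar.alpha w = 0) :
    bentGrid D (w :: (l ++ v :: l')) X = 0 := by
  obtain ⟨c, hc⟩ := bentGrid_move_back D l' v hl' X
  obtain ⟨d, hd⟩ : ∃ d : K, bendStep D v X = d • bendStep D v.bar X := by
    refine ⟨(formProd Q v.a₁ v.b₂)⁻¹ * formProd Q v.a₂ v.b₁, ?_⟩
    rw [mul_smul, ← hX.reflect v hv, inv_smul_smul₀ (hX.formProd_ne_zero hv)]
  have hz : bentGrid D (w :: ((l ++ l') ++ v.bar :: [])) X = 0 :=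
    bentGrid_eq_zero_of_alpha hl hw h0
  rw [bentGrid_cons, bentGrid_append] at hz
  rw [bentGrid_cons, bentGrid_append, bentGrid_cons, hc, hd, bentGrid_smul, bentGrid_smul,
    bentGrid_smul, ← bentGrid_append, bendStep_smul, bendStep_smul]
  rw [show bentGrid D [v.bar] X = bendStep D v.bar X from rfl] at hz
  rw [hz, smul_zero, smul_zero]

end Vanishing

/-! ### Frozen columns -/

section Frozen

variable {R : Type*} [CommRing R] {N M M' : ℕ}

/-- Adding a leftmost vertical edge carrying the arrow `c`. -/
def addCol (h : M' = M + 1) (c : Bool) (t : Fin M → Bool) : Fin M' → Bool := fun k =>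
  (Fin.cons c t : Fin (M + 1) → Bool) (Fin.cast h k)

/-- If the arrow on top of the leftmost column of `P` points down, then so does the arrow at its
bottom, and removing the column leaves `c` times `P'`. -/
def Frozen (h : M' = M + 1) (c : R) (P : Matrix (Fin (N + 1) → Bool) (Fin M' → Bool) R)
    (P' : Matrix (Fin N → Bool) (Fin M → Bool) R) : Prop :=
  ∀ s x t, P (Fin.cons true s) (addCol h x t) = if x = true then c * P' s t else 0

lemma frozen_rowOp (u : FermionRow R) (N : ℕ) (y : Bool) :
    Frozen rfl u.a₁ (rowOp u.weights (N + 1) true y) (rowOp u.weights N true y) := by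
  intro s x t
  change rowOp u.weights (N + 1) true y (Fin.cons true s) (Fin.cons x t) = _
  rw [rowOp_cons]
  cases x <;> simp [SixVertexWeights.weight, FermionRow.weights]

lemma Frozen.mul {L L' : ℕ} {h : M' = M + 1} {h' : L' = L + 1} {c d : R}
    {P : Matrix (Fin (N + 1) → Bool) (Fin M' → Bool) R}
    {P' : Matrix (Fin N → Bool) (Fin M → Bool) R}
    {Q : Matrix (Fin M' → Bool) (Fin L' → Bool) R} {Q' : Matrix (Fin M → Bool) (Fin L → Bool) R}
    (hP : Frozen h c P P') (hQ : ∀ s x t, Q (addCol h true s) (addCol h' x t) =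
      if x = true then d * Q' s t else 0) :
    Frozen h' (c * d) (P * Q) (P' * Q') := by
  subst h h'
  intro s x t
  have hP' : ∀ x t, P (Fin.cons true s) (Fin.cons x t) = if x = true then c * P' s t else 0 :=
    fun x t => hP s x t
  have hQ' : ∀ s t, Q (Fin.cons true s) (addCol rfl x t) = if x = true then d * Q' s t else 0 :=
    fun s t => hQ s x t
  rw [Matrix.mul_apply, sum_cons, Fintype.sum_bool]
  simp only [hP', hQ']
  cases x
  · simp
  · simp only [if_true, Matrix.mul_apply, Finset.mul_sum]
    simp
    exact Finset.sum_congr rfl fun _ _ => by ring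

lemma Frozen.mul_rowOp {h : M' = M + 1} {c : R}
    {P : Matrix (Fin (N + 1) → Bool) (Fin M' → Bool) R}
    {P' : Matrix (Fin N → Bool) (Fin M → Bool) R} (hP : Frozen h c P P') (u : FermionRow R)
    (y : Bool) :
    Frozen h (c * u.a₁) (P * rowOp u.weights M' true y) (P' * rowOp u.weights M true y) := by
  subst h
  exact hP.mul fun s x t => frozen_rowOp u M y s x t

lemma Frozen.bendStep {h : M' = M + 1} {c : R}
    {P : Matrix (Fin (N + 1) → Bool) (Fin M' → Bool) R}
    {P' : Matrix (Fin N → Bool) (Fin M → Bool) R} (hP : Frozen h c P P') (D : R)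
    (u : FermionRow R) :
    Frozen h (u.a₁ * u.a₂ * c) (bendStep D u P) (bendStep D u P') := by
  have h₁ : ∀ y z, Frozen h (u.a₁ * c * u.bar.a₁)
      (rowOp u.weights (N + 1) true y * P * rowOp u.bar.weights M' true z)
      (rowOp u.weights N true y * P' * rowOp u.bar.weights M true z) := fun y z =>
    Frozen.mul_rowOp ((frozen_rowOp u N y).mul hP) _ _
  intro s x t
  have e₁ := h₁ true false s x t
  have e₂ := h₁ false true s x t
  simp only [BentIce.bendStep, opA, opB, Matrix.add_apply, Matrix.smul_apply, smul_eq_mul, e₁, e₂]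
  cases x
  · simp
  · simp [FermionRow.bar]
    ring

end Frozen

/-! ### The outermost rows of the grid -/

section OuterRows

variable {R : Type*} [CommRing R]

/-- The arrows on the top edges of all columns point outward. -/
def allUp (N : ℕ) : Fin N → Bool := fun _ => false

/-- The arrows on the bottom edges of all columns point outward. -/
def allDown (N : ℕ) : Fin N → Bool := fun _ => true

lemma allUp_succ (N : ℕ) : allUp (N + 1) = Fin.cons false (allUp N) := by
  ext k; refine Fin.cases ?_ (fun _ => ?_) k <;> rfl

lemma allDown_succ (N : ℕ) : allDown (N + 1) = Fin.cons true (allDown N) := by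
  ext k; refine Fin.cases ?_ (fun _ => ?_) k <;> rfl

lemma allDown_eq_addCol {M M' : ℕ} (h : M' = M + 1) : allDown M' = addCol h true (allDown M) := by
  subst h
  exact allDown_succ M

lemma rowOp_false_allUp (u : FermionRow R) (N : ℕ) (y : Bool) (r : Fin N → Bool) :
    rowOp u.weights N false y (allUp N) r = if y = false ∧ r = allUp N then u.a₂ ^ N else 0 := by
  induction N with
  | zero =>
    rw [rowOp_zero]
    cases y <;> simp [Subsingleton.elim r (allUp 0)]
  | succ N ih =>
    obtain ⟨x, r, rfl⟩ : ∃ x r', r = Fin.cons x r' := ⟨_, _, (Fin.cons_self_tail r).symm⟩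
    rw [allUp_succ, rowOp_cons]
    simp only [ih, Fintype.sum_bool, Fin.cons_inj]
    cases x <;> simp [SixVertexWeights.weight, FermionRow.weights, pow_succ']

lemma opA_allUp (u : FermionRow R) (N : ℕ) (r : Fin N → Bool) :
    opA u N (allUp N) r = if r = allUp N then u.b₁ ^ N else 0 := by
  unfold opA
  induction N with
  | zero => simp [rowOp_zero, Subsingleton.elim r (allUp 0)]
  | succ N ih =>
    obtain ⟨x, r, rfl⟩ : ∃ x r', r = Fin.cons x r' := ⟨_, _, (Fin.cons_self_tail r).symm⟩
    rw [allUp_succ, rowOp_cons]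
    simp only [ih, Fintype.sum_bool, Fin.cons_inj, rowOp_false_allUp]
    cases x <;> simp [SixVertexWeights.weight, FermionRow.weights, pow_succ']

lemma opB_allUp_of_b₁_eq_zero (u : FermionRow R) (hu : u.b₁ = 0) (N : ℕ)
    (r : Fin (N + 1) → Bool) :
    opB u (N + 1) (allUp (N + 1)) r = if r = Fin.cons true (allUp N) then u.a₂ ^ N else 0 := by
  obtain ⟨x, r, rfl⟩ : ∃ x r', r = Fin.cons x r' := ⟨_, _, (Fin.cons_self_tail r).symm⟩
  unfold opB
  rw [allUp_succ, rowOp_cons]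
  simp only [Fintype.sum_bool, Fin.cons_inj, rowOp_false_allUp]
  cases x <;> simp [SixVertexWeights.weight, FermionRow.weights, hu]

lemma rowOp_false_true_allDown (u : FermionRow R) (N : ℕ) (r : Fin N → Bool) :
    rowOp u.weights N false true r (allDown N) = 0 := by
  induction N with
  | zero => simp [rowOp_zero]
  | succ N ih =>
    obtain ⟨x, r, rfl⟩ : ∃ x r', r = Fin.cons x r' := ⟨_, _, (Fin.cons_self_tail r).symm⟩
    rw [allDown_succ, rowOp_cons]
    simp only [ih, Fintype.sum_bool]
    cases x <;> simp [SixVertexWeights.weight]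

lemma opA_allDown (u : FermionRow R) (N : ℕ) (r : Fin N → Bool) :
    opA u N r (allDown N) = if r = allDown N then u.a₁ ^ N else 0 := by
  unfold opA
  induction N with
  | zero => simp [rowOp_zero, Subsingleton.elim r (allDown 0)]
  | succ N ih =>
    obtain ⟨x, r, rfl⟩ : ∃ x r', r = Fin.cons x r' := ⟨_, _, (Fin.cons_self_tail r).symm⟩
    rw [allDown_succ, rowOp_cons]
    simp only [ih, Fintype.sum_bool, Fin.cons_inj, rowOp_false_true_allDown]
    cases x <;> simp [SixVertexWeights.weight, FermionRow.weights, pow_succ']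

/-- If `b₁` vanishes in the outermost row, then the outermost bend and the leftmost column are
frozen. -/
lemma bendStep_allUp_allDown_of_b₁_eq_zero {N M M' : ℕ} (h : M' = M + 1) (D : R)
    (u : FermionRow R) (hu : u.b₁ = 0) {c : R}
    {P : Matrix (Fin (N + 1) → Bool) (Fin M' → Bool) R}
    {P' : Matrix (Fin N → Bool) (Fin M → Bool) R} (hP : Frozen h c P P') :
    bendStep D u P (allUp (N + 1)) (allDown M') =
      u.a₂ ^ (N + M') * c * P' (allUp N) (allDown M) := by
  simp only [bendStep, Matrix.add_apply, Matrix.smul_apply, Matrix.mul_apply, opA_allUp, hu,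
    opA_allDown, opB_allUp_of_b₁_eq_zero u hu]
  simp only [ne_eq, Nat.add_eq_zero_iff, one_ne_zero, and_false, not_false_eq_true, zero_pow,
    ite_self, zero_mul, Finset.sum_const_zero, smul_zero, ite_mul, mul_ite, mul_zero,
    Finset.sum_ite_eq', Finset.mem_univ, if_true, zero_add]
  rw [allDown_eq_addCol h, hP, if_pos rfl]
  simp only [FermionRow.bar]
  ring

end OuterRows

/-! ### The degree in the weight of the outermost row -/

section Degree

open Polynomial

variable {K : Type*} [Field K]

/-- The function `F` is given by a polynomial of degree less than `d`. For `d = 0` this means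
`F = 0`. -/
def PolyLT (d : ℕ) (F : K → K) : Prop := ∃ p : K[X], p.degree < d ∧ ∀ t, F t = p.eval t

lemma PolyLT.zero (d : ℕ) : PolyLT d fun _ : K => 0 :=
  ⟨0, by simp, by simp⟩

lemma PolyLT.const {d : ℕ} (hd : 0 < d) (c : K) : PolyLT d fun _ => c :=
  ⟨C c, degree_C_le.trans_lt (by exact_mod_cast hd), by simp⟩

lemma PolyLT.mono {d e : ℕ} {F : K → K} (hF : PolyLT d F) (h : d ≤ e) : PolyLT e F := by
  obtain ⟨p, hp, hF⟩ := hF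
  exact ⟨p, hp.trans_le (by exact_mod_cast h), hF⟩

lemma PolyLT.add {d : ℕ} {F G : K → K} (hF : PolyLT d F) (hG : PolyLT d G) :
    PolyLT d fun t => F t + G t := by
  obtain ⟨p, hp, hF⟩ := hF
  obtain ⟨q, hq, hG⟩ := hG
  exact ⟨p + q, (degree_add_le p q).trans_lt (max_lt hp hq),
    fun t => by simp only [hF, hG, eval_add]⟩

lemma PolyLT.sum {ι : Type*} {s : Finset ι} {d : ℕ} {F : ι → K → K}
    (hF : ∀ i ∈ s, PolyLT d (F i)) : PolyLT d fun t => ∑ i ∈ s, F i t := by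
  classical
  induction s using Finset.induction_on with
  | empty => simpa using PolyLT.zero d
  | insert i s hi ih =>
    simp only [Finset.sum_insert hi]
    exact (hF i (Finset.mem_insert_self i s)).add
      (ih fun j hj => hF j (Finset.mem_insert_of_mem hj))

lemma PolyLT.mul {d e f : ℕ} {F G : K → K} (hF : PolyLT d F) (hG : PolyLT e G)
    (h : d + e ≤ f + 1) : PolyLT f fun t => F t * G t := by
  obtain ⟨p, hp, hF⟩ := hF
  obtain ⟨q, hq, hG⟩ := hG
  refine ⟨p * q, ?_, fun t => by simp only [hF, hG, eval_mul]⟩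
  by_cases hp0 : p = 0
  · simp [hp0]
  by_cases hq0 : q = 0
  · simp [hq0]
  rw [degree_mul, degree_eq_natDegree hp0, degree_eq_natDegree hq0]
  rw [degree_eq_natDegree hp0] at hp
  rw [degree_eq_natDegree hq0] at hq
  norm_cast at hp hq ⊢
  omega

lemma PolyLT.const_mul {d : ℕ} {F : K → K} (hF : PolyLT d F) (c : K) :
    PolyLT d fun t => c * F t :=
  (PolyLT.const one_pos c).mul hF (by omega)

lemma PolyLT.id_mul {d : ℕ} {F : K → K} (hF : PolyLT d F) : PolyLT (d + 1) fun t => t * F t :=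
  PolyLT.mul (d := 2) ⟨X, by rw [degree_X]; exact_mod_cast one_lt_two, by simp⟩ hF (by omega)

/-- A row with variable weight `b₁`. -/
def varRow (w : FermionRow K) (t : K) : FermionRow K := ⟨w.a₁, w.a₂, t, w.b₂⟩

lemma polyLT_opA_allUp (w : FermionRow K) (N : ℕ) (r : Fin N → Bool) :
    PolyLT (N + 1) fun t => opA (varRow w t) N (allUp N) r := by
  simp only [opA_allUp]
  split_ifs
  · exact ⟨X ^ N, by rw [degree_X_pow]; exact_mod_cast N.lt_succ_self, by simp [varRow]⟩
  · exact PolyLT.zero _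

lemma polyLT_opB_allUp (w : FermionRow K) (N : ℕ) (r : Fin N → Bool) :
    PolyLT N fun t => opB (varRow w t) N (allUp N) r := by
  unfold opB
  induction N with
  | zero => simpa [rowOp_zero] using PolyLT.zero 0
  | succ N ih =>
    obtain ⟨x, r, rfl⟩ : ∃ x r', r = Fin.cons x r' := ⟨_, _, (Fin.cons_self_tail r).symm⟩
    simp only [allUp_succ, rowOp_cons, Fintype.sum_bool, rowOp_false_allUp]
    cases x
    · simpa [SixVertexWeights.weight, FermionRow.weights, varRow] using (ih r).id_mul
    · simp only [SixVertexWeights.weight, FermionRow.weights, varRow, zero_mul, one_mul, zero_add,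
        true_and]
      exact PolyLT.const N.succ_pos _

lemma polyLT_opA_bar_allDown (w : FermionRow K) (N : ℕ) (r : Fin N → Bool) :
    PolyLT 1 fun t => opA (varRow w t).bar N r (allDown N) := by
  simp only [opA_allDown]
  exact PolyLT.const one_pos (if r = allDown N then w.a₂ ^ N else 0)

lemma polyLT_rowOp_false_bar_allDown (w : FermionRow K) (N : ℕ) (r : Fin N → Bool) :
    PolyLT (N + 1) fun t => rowOp (varRow w t).bar.weights N false false r (allDown N) := by
  induction N with
  | zero => simpa [rowOp_zero] using PolyLT.const one_pos (1 : K)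
  | succ N ih =>
    obtain ⟨x, r, rfl⟩ : ∃ x r', r = Fin.cons x r' := ⟨_, _, (Fin.cons_self_tail r).symm⟩
    simp only [allDown_succ, rowOp_cons, Fintype.sum_bool]
    cases x
    · simpa [SixVertexWeights.weight] using PolyLT.zero (K := K) _
    · simpa [SixVertexWeights.weight, FermionRow.weights, varRow, FermionRow.bar] using
        (ih r).id_mul

lemma polyLT_opB_bar_allDown (w : FermionRow K) (N : ℕ) (r : Fin N → Bool) :
    PolyLT N fun t => opB (varRow w t).bar N r (allDown N) := by
  unfold opB
  induction N with
  | zero => simpa [rowOp_zero] using PolyLT.zero 0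
  | succ N ih =>
    obtain ⟨x, r, rfl⟩ : ∃ x r', r = Fin.cons x r' := ⟨_, _, (Fin.cons_self_tail r).symm⟩
    simp only [allDown_succ, rowOp_cons, Fintype.sum_bool]
    cases x
    · simpa [SixVertexWeights.weight, FermionRow.weights, varRow, FermionRow.bar] using
        polyLT_rowOp_false_bar_allDown w N r
    · simpa [SixVertexWeights.weight, FermionRow.weights, varRow, FermionRow.bar] using
        ((ih r).const_mul _).mono N.le_succ

lemma polyLT_bendStep {N M : ℕ} (D : K) (w : FermionRow K)
    (P : Matrix (Fin N → Bool) (Fin M → Bool) K) :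
    PolyLT (N + M) fun t => bendStep D (varRow w t) P (allUp N) (allDown M) := by
  simp only [bendStep, Matrix.add_apply, Matrix.smul_apply, Matrix.mul_apply, smul_eq_mul,
    Finset.sum_mul]
  refine PolyLT.add (PolyLT.const_mul (PolyLT.sum fun r _ => PolyLT.sum fun s _ => ?_) D)
    (PolyLT.sum fun r _ => PolyLT.sum fun s _ => ?_)
  -- the factors depending on `t` have degree at most `N` and less than `M`, or the reverse
  · simp only [mul_comm _ (P _ _), mul_assoc]
    exact ((polyLT_opA_allUp w N s).mul (polyLT_opB_bar_allDown w M r) (by omega)).const_mul _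
  · simp only [mul_comm _ (P _ _), mul_assoc]
    exact ((polyLT_opB_allUp w N s).mul (polyLT_opA_bar_allDown w M r) (by omega)).const_mul _

end Degree

/-! ### Polynomials with given zeros -/

section Roots

open Polynomial

variable {K : Type*} [Field K]

/-- Two linear forms are linearly independent. -/
def Indep {R : Type*} [CommRing R] (q r : R × R) : Prop := q.1 * r.2 ≠ r.1 * q.2

/-- A function given by a polynomial of degree at most the length of `L` which vanishes at the zeros
of the linear forms `L` is proportional to their product. -/
lemma PolyLT.eq_formProd {L : List (K × K)} {F : K → K} (hF : PolyLT (L.length + 1) F) {a : K}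
    (ha : a ≠ 0) (h0 : ∀ q ∈ L, q.1 ≠ 0 ∧ q.2 ≠ 0) (hL : L.Pairwise Indep)
    (hz : ∀ q ∈ L, ∀ t, linForm q a t = 0 → F t = 0) (t : K) :
    F t * formProd L a 0 = F 0 * formProd L a t := by
  obtain ⟨p, hp, hp'⟩ := hF
  -- both sides agree at the zeros of the forms and at `0`
  let pts : List K := 0 :: L.map fun q => -(q.1 * a) / q.2
  have hmem : ∀ q ∈ L, linForm q a (-(q.1 * a) / q.2) = 0 := by
    intro q hq
    have := (h0 q hq).2
    simp only [linForm]
    field_simp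
    ring
  have hnd : pts.Nodup := by
    refine List.nodup_cons.2 ⟨?_, ?_⟩
    · simp only [List.mem_map, not_exists, not_and]
      intro q hq h
      have h1 := (h0 q hq)
      rw [div_eq_zero_iff, neg_eq_zero, mul_eq_zero] at h
      tauto
    · refine List.Pairwise.map _ ?_ (hL.imp_of_mem (S := fun q r => Indep q r ∧ q.2 ≠ 0 ∧ r.2 ≠ 0)
        fun {q r} hq hr h => ⟨h, (h0 q hq).2, (h0 r hr).2⟩)
      rintro q r ⟨h, hq, hr⟩ e
      apply h
      rw [div_eq_div_iff hq hr] at e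
      exact mul_right_cancel₀ ha (by linear_combination -e)
  let Pl : K[X] := (L.map fun q => C (q.1 * a) + C q.2 * X).prod
  have hPl : ∀ t, Pl.eval t = formProd L a t := by
    intro t
    simp only [Pl, eval_list_prod, List.map_map, formProd]
    congr 1
    refine List.map_congr_left fun q _ => ?_
    simp [linForm]
  have hPd : Pl.natDegree ≤ L.length := by
    refine (natDegree_list_prod_le _).trans ?_
    rw [List.map_map]
    refine (List.sum_le_card_nsmul _ 1 ?_).trans (by simp)
    simp only [List.mem_map]
    rintro _ ⟨q, _, rfl⟩
    simp only [Function.comp]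
    compute_degree
  have key : p * C (formProd L a 0) - C (F 0) * Pl = 0 := by
    classical
    refine eq_zero_of_natDegree_lt_card_of_eval_eq_zero' _ pts.toFinset ?_ ?_
    · intro i hi
      rw [List.mem_toFinset, List.mem_cons, List.mem_map] at hi
      simp only [eval_sub, eval_mul, eval_C, hPl, ← hp']
      rcases hi with rfl | ⟨q, hq, rfl⟩
      · ring
      · rw [hz q hq _ (hmem q hq), formProd_eq_zero_iff.2 ⟨q, hq, hmem q hq⟩]
        ring
    · rw [List.toFinset_card_of_nodup hnd]
      simp only [pts, List.length_cons, List.length_map]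
      refine Nat.lt_succ_of_le ((natDegree_sub_le _ _).trans (max_le ?_ ?_))
      · refine (natDegree_mul_C_le _ _).trans ?_
        rw [degree_lt_iff_coeff_zero] at hp
        exact natDegree_le_iff_coeff_eq_zero.2 fun n hn => hp n hn
      · exact (natDegree_C_mul_le _ _).trans hPd
  have := congrArg (eval t) key
  simp only [eval_sub, eval_mul, eval_C, hPl, ← hp', eval_zero] at this
  exact sub_eq_zero.1 this

end Roots

/-! ### Removing the outermost bend -/

section Induction

variable {K : Type*} [Field K]

/-- The linear forms in the weights `a₂`, `b₁` of an outer row that come from exchanging it with the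
rows `l` and with their mirror images. -/
def pairForms {K : Type*} (l : List (FermionRow K)) : List (K × K) :=
  l.flatMap fun v => [(v.a₁, v.b₂), (v.a₂, v.b₁)]

lemma pairForms_cons {K : Type*} (w : FermionRow K) (l : List (FermionRow K)) :
    pairForms (w :: l) = [(w.a₁, w.b₂), (w.a₂, w.b₁)] ++ pairForms l := by
  simp [pairForms]

lemma length_pairForms {K : Type*} (l : List (FermionRow K)) :
    (pairForms l).length = 2 * l.length := by
  induction l with
  | nil => rfl
  | cons w l ih => rw [pairForms_cons, List.length_append, ih, List.length_cons]; simp; ring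

/-- Non-degeneracy of the weights in the rows `l` relative to the linear forms `S`. -/
structure Generic {R : Type*} [CommRing R] (S : List (R × R)) (l : List (FermionRow R)) : Prop where
  ne_zero : ∀ q ∈ S ++ pairForms l, q.1 ≠ 0 ∧ q.2 ≠ 0
  indep : (S ++ pairForms l).Pairwise Indep
  linForm_ne_zero : ∀ w ∈ l, ∀ q ∈ S, linForm q w.a₁ w.b₂ ≠ 0
  alpha_ne_zero : l.Pairwise fun u v =>
    u.alpha v ≠ 0 ∧ v.alpha u ≠ 0 ∧ u.alpha v.bar ≠ 0

variable {S Q : List (K × K)} {l : List (FermionRow K)} {w : FermionRow K}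

lemma Generic.tail (h : Generic S (w :: l)) : Generic S l := by
  have hs : (S ++ pairForms l).Sublist (S ++ pairForms (w :: l)) := by
    rw [pairForms_cons]
    exact List.Sublist.append_left (List.sublist_append_right _ _) _
  exact ⟨fun q hq => h.ne_zero q (hs.subset hq), h.indep.sublist hs,
    fun u hu => h.linForm_ne_zero u (List.mem_cons_of_mem _ hu), h.alpha_ne_zero.tail⟩

variable {N M : ℕ} {D : K} {X : Matrix (Fin N → Bool) (Fin M → Bool) K}

/-- The zeros of the partition function as a function of the weight `b₁` of the outermost row. -/
lemma bentGrid_varRow_eq_zero (hX : Reflects D X Q S) (h : Generic S (w :: l)) {q : K × K}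
    (hq : q ∈ Q ++ pairForms l) {t : K} (ht : linForm q w.a₂ t = 0) :
    bentGrid D (varRow w t :: l) X = 0 := by
  have hp := List.pairwise_cons.1 h.alpha_ne_zero
  have hw : ∀ u ∈ l, (varRow w t).alpha u ≠ 0 := fun u hu => (hp.1 u hu).1
  have hw' : ∀ u ∈ l, (varRow w t).alpha u.bar ≠ 0 := fun u hu => (hp.1 u hu).2.2
  rcases List.mem_append.1 hq with hQ | hl
  · exact bentGrid_eq_zero_of_linForm hX (h.linForm_ne_zero w List.mem_cons_self) hw ⟨q, hQ, ht⟩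
  · simp only [pairForms, List.mem_flatMap, List.mem_cons, List.not_mem_nil, or_false] at hl
    obtain ⟨v, hv, hqv⟩ := hl
    obtain ⟨l₁, l₂, rfl⟩ := List.append_of_mem hv
    have hp2 := List.pairwise_append.1 hp.2
    have hp3 := List.pairwise_cons.1 hp2.2.1
    rcases hqv with rfl | rfl
    · refine bentGrid_eq_zero_of_alpha (fun u hu => ?_) (hw v hv) ?_
      · exact (hp2.2.2 u hu v List.mem_cons_self).1
      · simpa [FermionRow.alpha, linForm, varRow, mul_comm] using ht
    · refine bentGrid_eq_zero_of_alpha_bar hX (h.linForm_ne_zero v (List.mem_cons_of_mem _ hv))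
        (fun u hu => ?_) (fun u hu => (hp3.1 u hu).1) (hw' v hv) ?_
      · rcases List.mem_append.1 hu with hu | hu
        · exact (hp2.2.2 u hu v List.mem_cons_self).2.2
        · have := (hp3.1 u hu).2.2
          simpa [FermionRow.alpha, FermionRow.bar, mul_comm] using this
      · simpa [FermionRow.alpha, FermionRow.bar, linForm, varRow, mul_comm] using ht

/-- The product of all linear forms in the partition function of the bent rows `l`. -/
def gridProd {R : Type*} [CommRing R] (Q : List (R × R)) : List (FermionRow R) → R
  | [] => 1
  | w :: l => formProd (Q ++ pairForms l) w.a₂ w.b₁ * gridProd Q l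

lemma formProd_append {R : Type*} [CommRing R] (Q Q' : List (R × R)) (a b : R) :
    formProd (Q ++ Q') a b = formProd Q a b * formProd Q' a b := by
  simp [formProd]

lemma frozen_bentGrid {M' : ℕ} (h : M' = M + 1) {c : K}
    {P : Matrix (Fin (N + 1) → Bool) (Fin M' → Bool) K}
    {P' : Matrix (Fin N → Bool) (Fin M → Bool) K} (hP : Frozen h c P P') :
    Frozen h ((l.map fun v => v.a₁ * v.a₂).prod * c) (bentGrid D l P) (bentGrid D l P') := by
  induction l with
  | nil => simpa [bentGrid] using hP
  | cons w l ih =>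
    rw [List.map_cons, List.prod_cons, mul_assoc]
    exact ih.bendStep D w

lemma formProd_zero (L : List (K × K)) (a : K) :
    formProd L a 0 = a ^ L.length * (L.map Prod.fst).prod := by
  induction L with
  | nil => simp [formProd]
  | cons q L ih =>
    simp only [formProd, List.map_cons, List.prod_cons, List.length_cons] at ih ⊢
    rw [ih]
    simp only [linForm]
    ring

lemma prod_fst_pairForms :
    ((pairForms l).map Prod.fst).prod = (l.map fun v => v.a₁ * v.a₂).prod := by
  induction l with
  | nil => rfl
  | cons w l ih =>
    rw [pairForms_cons, List.map_append, List.prod_append, ih]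
    simp

/-- Removing the outermost bend together with the leftmost column. As a function of the weight `b₁`
of the outermost row, the left side is determined up to a factor by its zeros, and the factor is
read off at `b₁ = 0`. -/
lemma bentGrid_cons_allUp_allDown {M' : ℕ} (hM : M' = M + 1)
    {P : Matrix (Fin (N + 1) → Bool) (Fin M' → Bool) K} (hX : Reflects D P Q S)
    (hP : Frozen hM (Q.map Prod.fst).prod P X) (h : Generic S (w :: l))
    (hlen : N + M' = Q.length + 2 * l.length) :
    bentGrid D (w :: l) P (allUp (N + 1)) (allDown M') =
      formProd (Q ++ pairForms l) w.a₂ w.b₁ * bentGrid D l X (allUp N) (allDown M) := by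
  have hs : (Q ++ pairForms l).Sublist (S ++ pairForms l) :=
    List.Sublist.append_right hX.sublist _
  have hne : ∀ q ∈ Q ++ pairForms l, q.1 ≠ 0 ∧ q.2 ≠ 0 := fun q hq =>
    h.tail.ne_zero q (hs.subset hq)
  have ha : w.a₂ ≠ 0 := by
    refine (h.ne_zero (w.a₂, w.b₁) ?_).1
    simp [pairForms_cons]
  have hL : (Q ++ pairForms l).length = N + M' := by
    rw [List.length_append, length_pairForms, hlen]
  have hF := polyLT_bendStep D w (bentGrid D l P)
  have key := PolyLT.eq_formProd (L := Q ++ pairForms l) (hF.mono (by omega)) ha hne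
    (h.tail.indep.sublist hs)
    (fun q hq t ht => by
      have := bentGrid_varRow_eq_zero hX h hq ht
      rw [bentGrid_cons] at this
      rw [this]; rfl) w.b₁
  rw [bendStep_allUp_allDown_of_b₁_eq_zero hM D (varRow w 0) rfl (frozen_bentGrid hM hP),
    formProd_zero, hL, List.map_append, List.prod_append, prod_fst_pairForms] at key
  have hc : w.a₂ ^ (N + M') * ((Q.map Prod.fst).prod * (l.map fun v => v.a₁ * v.a₂).prod) ≠ 0 := by
    refine mul_ne_zero (pow_ne_zero _ ha) ?_
    rw [← prod_fst_pairForms, ← List.prod_append, ← List.map_append, Ne, List.prod_eq_zero_iff]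
    simp only [List.mem_map, not_exists, not_and]
    exact fun q hq => (hne q hq).1
  refine mul_right_cancel₀ hc ?_
  rw [bentGrid_cons]
  refine key.trans ?_
  simp only [varRow]
  ring

end Induction

/-! ### The six families -/

section Families

/-- The part of a bent grid enclosed by the bends, for each of the families: the central row with
weights `a`, `b`, and the top edge of the half column. -/
def center {R : Type*} [CommRing R] (I a b : R) : (F : IceFamily) → (N : ℕ) →
    Matrix (Fin N → Bool) (Fin (N + F.half) → Bool) R
  | .B, N => (1 : Matrix (Fin N → Bool) (Fin N → Bool) R)
  | .BStar, N => opA (centralFermion a b) N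
  | .C, N => cornerCenter I a b N
  | .CStar, N => halfTop R N true
  | .D, N => halfTop R N false
  | .BC, N => opB (centralFermion a b) N

/-- All linear forms occurring in the reflection of an innermost bend. -/
def specialForms {R : Type*} [CommRing R] (I a b : R) : List (R × R) := [(1, I), (1, -I), (a, b)]

/-- The linear forms occurring in the reflection of an innermost bend. -/
def familyForms {R : Type*} [CommRing R] (I a b : R) : IceFamily → List (R × R)
  | .B => [(1, I)]
  | .BStar => [(a, b)]
  | .C => [(1, I), (a, b)]
  | .CStar => [(1, I), (1, -I)]
  | .D => []
  | .BC => [(1, I), (1, -I), (a, b)]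

lemma familyForms_sublist {R : Type*} [CommRing R] (I a b : R) (F : IceFamily) :
    (familyForms I a b F).Sublist (specialForms I a b) := by
  cases F <;> simp only [familyForms, specialForms]
  · simp
  · simp
  · exact List.Sublist.cons_cons _ (List.Sublist.cons _ (List.Sublist.refl _))
  · simp
  · simp
  · simp

variable {K : Type*} [Field K]

lemma reflects_center {I : K} (hI : I * I = -1) (a b : K) (F : IceFamily) (N : ℕ) :
    Reflects (bendD I F) (center I a b F N) (familyForms I a b F) (specialForms I a b) := by
  refine ⟨familyForms_sublist I a b F, fun w hw => ?_⟩
  simp only [specialForms, List.mem_cons, List.not_mem_nil, or_false, forall_eq_or_imp,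
    forall_eq, linForm, one_mul] at hw
  obtain ⟨h₁, h₂, h₃⟩ := hw
  have hr : w.alpha w.bar ≠ 0 := by
    have : w.alpha w.bar = (w.a₁ + I * w.b₂) * (w.a₁ + -I * w.b₂) := by
      simp only [FermionRow.alpha, FermionRow.bar]
      linear_combination w.b₂ ^ 2 * hI
    rw [this]
    exact mul_ne_zero h₁ h₂
  have hk : w.alpha (centralFermion a b) ≠ 0 := by
    simpa [FermionRow.alpha, centralFermion, mul_comm] using h₃
  have hk' : (centralFermion a b).alpha w.bar ≠ 0 := by
    simpa [FermionRow.alpha, centralFermion, FermionRow.bar, mul_comm] using h₃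
  have hsq : ∀ x y : K, (x + I * y) * (x + -I * y) = x ^ 2 + y ^ 2 := fun x y => by
    linear_combination -y ^ 2 * hI
  cases F <;> simp only [familyForms, formProd, linForm, List.map_cons, List.map_nil,
    List.prod_cons, List.prod_nil, mul_one, one_mul, one_smul, bendD, center]
  · exact smul_right_injective _ hr (fish_one I hI w N)
  · exact smul_right_injective _ (mul_ne_zero (mul_ne_zero hk hr) hk') (fish_opA a b w N)
  · refine smul_right_injective _ (mul_ne_zero h₃ ?_) (fish_cornerCenter I hI a b w N)
    rwa [sub_eq_add_neg, ← neg_mul]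
  · rw [hsq, hsq]
    exact smul_right_injective _ hr (fish_halfTop_true w N)
  · exact smul_right_injective _ hr (fish_halfTop_false w N)
  · rw [← mul_assoc, ← mul_assoc, hsq, hsq, mul_comm _ (a * w.a₁ + _),
      mul_comm _ (a * w.a₂ + _)]
    exact smul_right_injective _ (mul_ne_zero (mul_ne_zero hk hr) hk') (fish_opB a b w N)

lemma frozen_halfTop {R : Type*} [CommRing R] (N : ℕ) (x : Bool) :
    Frozen (rfl : N + 2 = N + 1 + 1) 1 (halfTop R (N + 1) x) (halfTop R N x) := by
  intro s y t
  have : (Fin.snoc (Fin.cons true s : Fin (N + 1) → Bool) x : Fin (N + 2) → Bool) =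
      Fin.cons true (Fin.snoc s x : Fin (N + 1) → Bool) :=
    (Fin.cons_snoc_eq_snoc_cons true s x).symm
  simp only [halfTop, this]
  change (if (Fin.cons y t : Fin (N + 2) → Bool) = _ then _ else _) = _
  simp only [Fin.cons_inj]
  cases y <;> simp

lemma frozen_one {R : Type*} [CommRing R] (N : ℕ) :
    Frozen (rfl : N + 1 = N + 1) 1 (1 : Matrix (Fin (N + 1) → Bool) (Fin (N + 1) → Bool) R) 1 := by
  intro s x t
  change (1 : Matrix (Fin (N + 1) → Bool) (Fin (N + 1) → Bool) R) (Fin.cons true s)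
    (Fin.cons x t) = _
  simp only [Matrix.one_apply, Fin.cons_inj]
  cases x <;> simp

lemma frozen_cornerCenter {R : Type*} [CommRing R] (I a b : R) (N : ℕ) :
    Frozen (rfl : N + 2 = N + 1 + 1) a (cornerCenter I a b (N + 1)) (cornerCenter I a b N) := by
  have h : ∀ y x, Frozen (rfl : N + 2 = N + 1 + 1) (a * 1)
      (rowOp (centralFermion a b).weights (N + 1) true y * halfTop R (N + 1) x)
      (rowOp (centralFermion a b).weights N true y * halfTop R N x) := fun y x =>
    (frozen_rowOp (centralFermion a b) N y).mul (frozen_halfTop N x)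
  intro s x t
  refine (congrArg₂ (fun u v => u + (a - I * b) * v) (h true true s x t)
    (h false false s x t)).trans ?_
  cases x
  · simp
  · simp only [if_true, cornerCenter, opA, opB, Matrix.add_apply, Matrix.smul_apply, smul_eq_mul]
    ring

lemma frozen_center (I a b : K) (F : IceFamily) (N : ℕ) :
    Frozen (show N + 1 + F.half = N + F.half + 1 by omega)
      ((familyForms I a b F).map Prod.fst).prod (center I a b F (N + 1)) (center I a b F N) := by
  cases F <;> simp only [familyForms, List.map_cons, List.map_nil, List.prod_cons, List.prod_nil,
    mul_one, one_mul, center]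
  · exact frozen_one N
  · exact frozen_rowOp (centralFermion a b) N true
  · exact frozen_cornerCenter I a b N
  · exact frozen_halfTop N true
  · exact frozen_halfTop N false
  · exact frozen_rowOp (centralFermion a b) N false

lemma allDown_one : allDown 1 = (Fin.snoc (allUp 0) true : Fin 1 → Bool) := by
  decide

/-- The partition function of a bent grid, by induction on the number of its bends. -/
theorem bentGrid_center {I : K} (hI : I * I = -1) (a b : K) (F : IceFamily)
    (l : List (FermionRow K)) (N : ℕ) (hl : Generic (specialForms I a b) l)
    (hlen : 2 * N + F.half + 1 = (familyForms I a b F).length + 2 * l.length) :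
    bentGrid (bendD I F) l (center I a b F N) (allUp N) (allDown (N + F.half)) =
      gridProd (familyForms I a b F) l := by
  induction l generalizing N with
  | nil =>
    simp only [bentGrid, List.foldr_nil, gridProd]
    cases F <;> simp only [IceFamily.half, familyForms, List.length_cons, List.length_nil] at hlen
    · obtain rfl : N = 0 := by omega
      exact (Matrix.one_apply (α := K)).trans (if_pos (Subsingleton.elim _ _))
    · obtain rfl : N = 0 := by omega
      exact (opA_allDown (centralFermion a b) 0 (allUp 0)).trans
        (by rw [if_pos (Subsingleton.elim _ _), pow_zero])
    · obtain rfl : N = 0 := by omega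
      change (opA (centralFermion a b) 0 * halfTop K 0 true + (a - I * b) •
        (opB (centralFermion a b) 0 * halfTop K 0 false)) (allUp 0) (allDown 1) = _
      rw [allDown_one, Matrix.add_apply, Matrix.smul_apply, mul_halfTop_snoc, mul_halfTop_snoc]
      simp [opA, rowOp_zero]
    · obtain rfl : N = 0 := by omega
      change halfTop K 0 true (allUp 0) (allDown 1) = _
      rw [halfTop, if_pos allDown_one]
    · omega
    · obtain rfl : N = 1 := by omega
      change opB (centralFermion a b) 1 (allUp 1) (allDown 1) = _
      rw [opB, allUp_succ, allDown_succ, rowOp_cons]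
      simp [rowOp_zero, SixVertexWeights.weight, FermionRow.weights]
  | cons w l ih =>
    cases N with
    | zero =>
      cases F <;>
        simp only [IceFamily.half, familyForms, List.length_cons, List.length_nil] at hlen <;>
        first | omega | skip
      obtain rfl : l = [] := List.length_eq_zero_iff.1 (by omega)
      change bendStep 1 w (halfTop K 0 false) (allUp 0) (allDown 1) = _
      rw [bendStep, Matrix.mul_assoc, halfTop_false_opB, Matrix.mul_assoc, halfTop_false_opA,
        one_smul, Matrix.mul_add, Matrix.mul_smul, Matrix.mul_smul, ← Matrix.mul_assoc,
        ← Matrix.mul_assoc, ← Matrix.mul_assoc, allDown_one, Matrix.add_apply, Matrix.add_apply,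
        Matrix.smul_apply, Matrix.smul_apply, mul_halfTop_snoc, mul_halfTop_snoc,
        mul_halfTop_snoc, Matrix.mul_apply]
      simp [opA, rowOp_zero, gridProd, formProd, familyForms, pairForms]
    | succ N =>
      rw [bentGrid_cons_allUp_allDown _ (reflects_center hI a b F (N + 1))
        (frozen_center I a b F N) hl, ih N hl.tail]
      · rfl
      · rw [List.length_cons] at hlen; omega
      · rw [List.length_cons] at hlen; omega

end Families

/-! ### Peeling off the bends of a state -/

section States

variable {p c N H : ℕ}

/-- The arrows on the top edges of the full columns. -/
def topEdges (A : IceState p c N H) : Fin N → Bool := fun k => A.ver k 0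

/-- The arrows on the bottom edges of all columns. -/
def bottomEdges (A : IceState p c N H) : Fin (N + H) → Bool :=
  Fin.append (fun k => A.ver k (Fin.last _)) (fun h => A.hver h (Fin.last _))

/-- Removing the outermost bent pair of rows. -/
def inner (A : IceState (p + 1) c N H) : IceState p c N H where
  top j := A.top j.succ
  mid := A.mid
  bot j := A.bot j.succ
  ver k s := A.ver k ⟨s + 1, by omega⟩
  hver h s := A.hver h s.castSucc

/-- A state of a bent grid is determined by its outermost bent pair of rows, the boundary edges of
its columns, and the state inside. -/
def peel : IceState (p + 1) c N H ≃ (Fin (N + 1) → Bool) × (Fin (N + H + 1) → Bool) ×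
    (Fin N → Bool) × (Fin (N + H) → Bool) × IceState p c N H where
  toFun A := (A.top 0, A.bot 0, topEdges A, bottomEdges A, inner A)
  invFun x :=
    { top := Fin.cons x.1 x.2.2.2.2.top
      mid := x.2.2.2.2.mid
      bot := Fin.cons x.2.1 x.2.2.2.2.bot
      ver := fun k s => if h₀ : s.val = 0 then x.2.2.1 k else
        if h₁ : s.val - 1 < p + c + p + 1 then x.2.2.2.2.ver k ⟨s - 1, h₁⟩
        else x.2.2.2.1 (Fin.castAdd H k)
      hver := fun h => Fin.snoc (x.2.2.2.2.hver h) (x.2.2.2.1 (Fin.natAdd N h)) }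
  left_inv A := by
    obtain ⟨top, mid, bot, ver, hver⟩ := A
    simp only [inner, topEdges, bottomEdges, IceState.mk.injEq, true_and]
    refine ⟨Fin.cons_self_tail top, Fin.cons_self_tail bot, ?_, ?_⟩
    · funext k s
      obtain ⟨s, hs⟩ := s
      simp only [Fin.append_left]
      split_ifs with h₀ h₁
      · subst h₀; rfl
      · congr 2; omega
      · congr 1; ext; simp; omega
    · funext h s
      refine Fin.lastCases ?_ (fun s => ?_) s
      · simp
      · simp
  right_inv x := by
    obtain ⟨t, b, τ, β, ⟨top, mid, bot, ver, hver⟩⟩ := x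
    simp only [inner, bottomEdges, Prod.mk.injEq, IceState.mk.injEq, true_and]
    refine ⟨rfl, rfl, rfl, ?_, rfl, rfl, ?_, ?_⟩
    · funext k
      refine Fin.addCases (fun k => ?_) (fun k => ?_) k
      · rw [Fin.append_left, dif_neg (by simp), dif_neg (by simp)]
      · simp
    · funext k s
      rw [dif_neg (by simp), dif_pos (by simp; omega)]
      rfl
    · funext h s
      simp

variable {R : Type*} [CommRing R]

/-- The weight of a bent pair of rows with horizontal edges `t`, `b`, the vertical edges `σ`, `σ'`
above and below the upper row and the vertical edges `ρ`, `ρ'` above and below the lower row. -/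
def bentFactor (D : R) (u : FermionRow R) (t : Fin (N + 1) → Bool) (b : Fin (N + H + 1) → Bool)
    (σ σ' : Fin N → Bool) (ρ ρ' : Fin (N + H) → Bool) : R :=
  if t 0 = true ∧ b 0 = true ∧ b (Fin.last _) = !t (Fin.last _) then
    (if t (Fin.last _) = true then D else 1) *
      (∏ k, u.weights.weight ⟨t k.castSucc, σ k, t k.succ, σ' k⟩) *
      ∏ k, u.bar.weights.weight ⟨b k.castSucc, ρ k, b k.succ, ρ' k⟩
  else 0

lemma sum_bentFactor (D : R) (u : FermionRow R) (σ σ' : Fin N → Bool) (ρ ρ' : Fin (N + H) → Bool) :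
    ∑ t, ∑ b, bentFactor D u t b σ σ' ρ ρ' =
      D * (opA u N σ σ' * opB u.bar (N + H) ρ ρ') +
        opB u N σ σ' * opA u.bar (N + H) ρ ρ' := by
  simp only [opA, opB, rowOp]
  rw [Finset.sum_mul_sum, Finset.sum_mul_sum, Finset.mul_sum, ← Finset.sum_add_distrib]
  refine Finset.sum_congr rfl fun t _ => ?_
  rw [Finset.mul_sum, ← Finset.sum_add_distrib]
  refine Finset.sum_congr rfl fun b _ => ?_
  unfold bentFactor
  cases t 0 <;> cases b 0 <;> cases t (Fin.last N) <;> cases b (Fin.last (N + H)) <;> simp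
  ring

/-- The weight of the `j`-th bent pair of rows of a state. -/
def stateFactor (D : R) (u : Fin p → FermionRow R) (A : IceState p c N H) (j : Fin p) : R :=
  bentFactor D (u j) (A.top j) (A.bot j)
    (fun k => A.ver k ⟨j, by omega⟩) (fun k => A.ver k ⟨j + 1, by omega⟩)
    (Fin.append (fun k => A.ver k ⟨p + c + (p - 1 - j), by omega⟩)
      (fun h => A.hver h ⟨p - 1 - j, by omega⟩))
    (Fin.append (fun k => A.ver k ⟨p + c + (p - 1 - j) + 1, by omega⟩)
      (fun h => A.hver h ⟨p - 1 - j + 1, by omega⟩))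

lemma stateFactor_succ (D : R) (u : Fin (p + 1) → FermionRow R) (A : IceState (p + 1) c N H)
    (j : Fin p) :
    stateFactor D u A j.succ = stateFactor D (fun i => u i.succ) (inner A) j := by
  unfold stateFactor
  refine congrArg₂ (bentFactor D _ _ _ _ _) ?_ ?_
  all_goals
    refine congrArg₂ Fin.append (funext fun k => congrArg (A.ver k) (Fin.ext ?_))
      (funext fun h => congrArg (A.hver h) (Fin.ext ?_))
    · simp only [Fin.val_succ]; omega
    · simp only [Fin.val_succ, Fin.val_castSucc]; omega

lemma stateFactor_zero (D : R) (u : Fin (p + 1) → FermionRow R) (A : IceState (p + 1) c N H) :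
    stateFactor D u A 0 = bentFactor D (u 0) (A.top 0) (A.bot 0) (topEdges A)
      (topEdges (inner A)) (bottomEdges (inner A)) (bottomEdges A) := by
  unfold stateFactor
  refine congrArg₂ (bentFactor D _ _ _ _ _) ?_ ?_
  all_goals
    refine congrArg₂ Fin.append (funext fun k => congrArg (A.ver k) (Fin.ext ?_))
      (funext fun h => congrArg (A.hver h) (Fin.ext ?_))
    · simp; try omega
    · simp

/-- The arrows on the edges of the central row, on the vertical edges next to it and on the top edge
of the half column. -/
abbrev CoreState (c N H : ℕ) : Type :=
  (Fin c → Fin (N + 1) → Bool) × (Fin N → Fin (c + 1) → Bool) × (Fin H → Bool)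

/-- The part of a state enclosed by all bends. -/
def core (A : IceState p c N H) : CoreState c N H :=
  (A.mid, fun k s => A.ver k ⟨p + s, by omega⟩, fun h => A.hver h 0)

lemma core_inner (A : IceState (p + 1) c N H) : core (inner A) = core A := by
  simp only [core, inner]
  refine Prod.ext rfl (Prod.ext ?_ rfl)
  funext k s
  simp only
  congr 2
  omega

/-- The partition function of a bent grid with the bent rows `u`, whose part enclosed by the bends
has the weight `W`, as a matrix indexed by the boundary edges of the columns. -/
def stateSum (D : R) (u : Fin p → FermionRow R) (W : CoreState c N H → R) :
    Matrix (Fin N → Bool) (Fin (N + H) → Bool) R := fun τ β =>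
  ∑ A : IceState p c N H, if topEdges A = τ ∧ bottomEdges A = β then
    (∏ j, stateFactor D u A j) * W (core A) else 0

lemma sum_mul_stateSum_mul (D : R) (u : Fin p → FermionRow R) (W : CoreState c N H → R)
    (P : Matrix (Fin N → Bool) (Fin N → Bool) R)
    (Q : Matrix (Fin (N + H) → Bool) (Fin (N + H) → Bool) R) (τ : Fin N → Bool)
    (β : Fin (N + H) → Bool) :
    (P * stateSum D u W * Q) τ β = ∑ A : IceState p c N H,
      (∏ j, stateFactor D u A j) * W (core A) * (P τ (topEdges A) * Q (bottomEdges A) β) := by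
  simp only [Matrix.mul_apply, stateSum, Finset.mul_sum, Finset.sum_mul]
  rw [Finset.sum_congr rfl fun _ _ => Finset.sum_comm, Finset.sum_comm]
  refine Finset.sum_congr rfl fun A _ => ?_
  rw [Finset.sum_eq_single (bottomEdges A), Finset.sum_eq_single (topEdges A)]
  · rw [if_pos ⟨rfl, rfl⟩]
    ring
  · intro s _ hs
    simp [hs.symm]
  · simp
  · intro s _ hs
    simp [hs.symm]
  · simp

lemma stateSum_succ (D : R) (u : Fin (p + 1) → FermionRow R) (W : CoreState c N H → R) :
    stateSum D u W = bendStep D (u 0) (stateSum D (fun i => u i.succ) W) := by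
  ext τ β
  have hL : stateSum D u W τ β = ∑ A : IceState p c N H,
      ((∏ j, stateFactor D (fun i => u i.succ) A j) * W (core A)) *
        ∑ t, ∑ b, bentFactor D (u 0) t b τ (topEdges A) (bottomEdges A) β := by
    let g : (Fin (N + 1) → Bool) × (Fin (N + H + 1) → Bool) ×
        (Fin N → Bool) × (Fin (N + H) → Bool) × IceState p c N H → R := fun x =>
      if x.2.2.1 = τ ∧ x.2.2.2.1 = β then
        ((∏ j, stateFactor D (fun i => u i.succ) x.2.2.2.2 j) * W (core x.2.2.2.2)) *
          bentFactor D (u 0) x.1 x.2.1 x.2.2.1 (topEdges x.2.2.2.2) (bottomEdges x.2.2.2.2)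
            x.2.2.2.1 else 0
    have hg : ∀ A : IceState (p + 1) c N H, (if topEdges A = τ ∧ bottomEdges A = β then
        (∏ j, stateFactor D u A j) * W (core A) else 0) = g (peel A) := by
      intro A
      simp only [g, peel, Equiv.coe_fn_mk, Fin.prod_univ_succ, stateFactor_succ, stateFactor_zero,
        core_inner]
      congr 1
      ring
    rw [stateSum, Fintype.sum_congr _ _ hg, Equiv.sum_comp peel g]
    simp only [Fintype.sum_prod_type, Finset.mul_sum]
    rw [Finset.sum_comm (s := (Finset.univ : Finset (IceState p c N H)))]
    refine Finset.sum_congr rfl fun t _ => ?_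
    rw [Finset.sum_comm (s := (Finset.univ : Finset (IceState p c N H)))]
    refine Finset.sum_congr rfl fun b _ => ?_
    rw [Finset.sum_eq_single τ, Finset.sum_eq_single β]
    · simp [g]
    · intro x _ hx
      simp [g, hx]
    · simp
    · intro x _ hx
      simp [g, hx]
    · simp
  rw [hL]
  simp only [sum_bentFactor]
  simp only [bendStep, Matrix.add_apply, Matrix.smul_apply, sum_mul_stateSum_mul, smul_eq_mul,
    Finset.mul_sum, ← Finset.sum_add_distrib]
  exact Finset.sum_congr rfl fun A _ => by ring

lemma stateSum_eq_bentGrid {K : Type*} [Field K] (D : K) (u : Fin p → FermionRow K)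
    (W : CoreState c N H → K) :
    stateSum D u W = bentGrid D (List.ofFn u) (stateSum (p := 0) D Fin.elim0 W) := by
  induction p with
  | zero =>
    rw [List.ofFn_zero, Subsingleton.elim u Fin.elim0]
    rfl
  | succ p ih => rw [stateSum_succ, ih, List.ofFn_succ, bentGrid_cons]

end States

/-! ### The part of a state enclosed by all bends -/

section Core

variable {R : Type*} [CommRing R] {p c N H : ℕ}

/-- The boundary condition at the right end of the central row and at the top of the half column,
together with the weight of the corner vertex. -/
def endWeight (I a b : R) (F : IceFamily) (x : CoreState c N H) : R :=
  match F with
  | .B => 1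
  | .BStar => if ∀ r, x.1 r (Fin.last N) = true then 1 else 0
  | .C => if ∀ r h, x.1 r (Fin.last N) = x.2.2 h then
      ∏ r, (if x.1 r (Fin.last N) = true then 1 else a - I * b) else 0
  | .CStar => if ∀ h, x.2.2 h = true then 1 else 0
  | .D => if ∀ h, x.2.2 h = false then 1 else 0
  | .BC => if ∀ r, x.1 r (Fin.last N) = false then 1 else 0

/-- The weight of the part of a state enclosed by all bends. -/
def coreWeight (I a b : R) (F : IceFamily) (x : CoreState c N H) : R :=
  (∏ r, if x.1 r 0 = true then ∏ k, (centralFermion a b).weights.weight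
    ⟨x.1 r k.castSucc, x.2.1 k r.castSucc, x.1 r k.succ, x.2.1 k r.succ⟩ else 0) *
  endWeight I a b F x

/-- The states of a grid without any rows. -/
def emptyGridEquiv : IceState 0 0 N H ≃ (Fin N → Bool) × (Fin H → Bool) where
  toFun A := (topEdges A, fun h => A.hver h 0)
  invFun x := ⟨Fin.elim0, Fin.elim0, Fin.elim0, fun k _ => x.1 k, fun h _ => x.2 h⟩
  left_inv A := by
    obtain ⟨top, mid, bot, ver, hver⟩ := A
    simp only [topEdges, IceState.mk.injEq]
    refine ⟨funext fun j => j.elim0, funext fun j => j.elim0, funext fun j => j.elim0,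
      funext fun k => funext fun s => congrArg _ (Subsingleton.elim (α := Fin 1) _ _),
      funext fun k => funext fun s => congrArg _ (Subsingleton.elim (α := Fin 1) _ _)⟩
  right_inv x := rfl

/-- The states of a grid whose only row is a central row. -/
def centralGridEquiv : IceState 0 1 N H ≃
    (Fin (N + 1) → Bool) × (Fin N → Bool) × (Fin N → Bool) × (Fin H → Bool) where
  toFun A := (A.mid 0, topEdges A, fun k => A.ver k (Fin.last _), fun h => A.hver h 0)
  invFun x := ⟨Fin.elim0, fun _ => x.1, Fin.elim0,
    fun k s => if s = 0 then x.2.1 k else x.2.2.1 k, fun h _ => x.2.2.2 h⟩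
  left_inv A := by
    obtain ⟨top, mid, bot, ver, hver⟩ := A
    simp only [topEdges, IceState.mk.injEq]
    refine ⟨funext fun j => j.elim0,
      funext fun r => congrArg mid (Subsingleton.elim (α := Fin 1) _ _),
      funext fun j => j.elim0, funext fun k => funext fun s => ?_,
      funext fun k => funext fun s => congrArg _ (Subsingleton.elim (α := Fin 1) _ _)⟩
    revert s
    change ∀ s : Fin 2, _
    intro s
    fin_cases s <;> rfl
  right_inv x := rfl

lemma stateSum_empty (D : R) (W : CoreState 0 N H → R) (τ : Fin N → Bool)
    (β : Fin (N + H) → Bool) :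
    stateSum (p := 0) D Fin.elim0 W τ β =
      ∑ x : Fin H → Bool, if Fin.append τ x = β then W (Fin.elim0, fun k _ => τ k, x) else 0 := by
  rw [stateSum, ← emptyGridEquiv.symm.sum_comp, Fintype.sum_prod_type,
    Finset.sum_eq_single τ]
  · refine Finset.sum_congr rfl fun x _ => ?_
    have h₁ : topEdges (emptyGridEquiv.symm (τ, x)) = τ := rfl
    have h₂ : bottomEdges (emptyGridEquiv.symm (τ, x)) = Fin.append τ x := rfl
    have h₃ : core (emptyGridEquiv.symm (τ, x)) = (Fin.elim0, fun k _ => τ k, x) := rfl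
    simp [h₁, h₂, h₃]
  · intro v _ hv
    refine Finset.sum_eq_zero fun x _ => if_neg ?_
    rintro ⟨h, -⟩
    exact hv h
  · simp

lemma stateSum_central (D : R) (W : CoreState 1 N H → R) (τ : Fin N → Bool)
    (β : Fin (N + H) → Bool) :
    stateSum (p := 0) D Fin.elim0 W τ β =
      ∑ v : Fin N → Bool, ∑ x : Fin H → Bool, if Fin.append v x = β then
        ∑ e : Fin (N + 1) → Bool, W (fun _ => e, fun k s => if s = 0 then τ k else v k, x)
      else 0 := by
  rw [stateSum, ← centralGridEquiv.symm.sum_comp, Fintype.sum_prod_type]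
  have h : ∀ e : Fin (N + 1) → Bool, ∑ y : (Fin N → Bool) × (Fin N → Bool) × (Fin H → Bool),
      (if topEdges (centralGridEquiv.symm (e, y)) = τ ∧
        bottomEdges (centralGridEquiv.symm (e, y)) = β then
        (∏ j, stateFactor D Fin.elim0 (centralGridEquiv.symm (e, y)) j) *
          W (core (centralGridEquiv.symm (e, y))) else 0) =
      ∑ v : Fin N → Bool, ∑ x : Fin H → Bool, if Fin.append v x = β then
        W (fun _ => e, fun k s => if s = 0 then τ k else v k, x) else 0 := by
    intro e
    rw [Fintype.sum_prod_type, Finset.sum_eq_single τ]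
    · rw [Fintype.sum_prod_type]
      refine Finset.sum_congr rfl fun v _ => Finset.sum_congr rfl fun x _ => ?_
      have h₁ : topEdges (centralGridEquiv.symm (e, τ, v, x)) = τ := rfl
      have h₂ : bottomEdges (centralGridEquiv.symm (e, τ, v, x)) = Fin.append v x := rfl
      have h₃ : core (centralGridEquiv.symm (e, τ, v, x)) =
          (fun _ => e, fun k s => if s = 0 then τ k else v k, x) := by
        refine Prod.ext rfl (Prod.ext (funext fun k => funext fun s => ?_) rfl)
        fin_cases s <;> rfl
      simp [h₁, h₂, h₃]
    · intro v _ hv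
      refine Finset.sum_eq_zero fun x _ => if_neg ?_
      rintro ⟨h, -⟩
      exact hv h
    · simp
  simp only [h]
  rw [Finset.sum_comm]
  refine Finset.sum_congr rfl fun v _ => ?_
  rw [Finset.sum_comm]
  refine Finset.sum_congr rfl fun x _ => ?_
  split_ifs <;> simp

lemma append_zero (v : Fin N → Bool) (x : Fin 0 → Bool) :
    (Fin.append v x : Fin (N + 0) → Bool) = v := by
  funext k
  exact Fin.append_left v x k

lemma sum_fin_one {A : Type*} [AddCommMonoid A] (f : (Fin 1 → Bool) → A) :
    ∑ x, f x = f (fun _ => true) + f (fun _ => false) := by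
  rw [← (Equiv.funUnique (Fin 1) Bool).symm.sum_comp, Fintype.sum_bool]
  rfl

lemma append_one (v : Fin N → Bool) (y : Bool) :
    (Fin.append v (fun _ : Fin 1 => y) : Fin (N + 1) → Bool) = Fin.snoc v y := by
  rw [Fin.append_right_eq_snoc]

lemma sum_coreWeight (I a b : R) (F : IceFamily) (τ v : Fin N → Bool) (x : Fin H → Bool)
    (f : Bool → R) (hf : ∀ (e : Fin (N + 1) → Bool) (z : Fin N → Fin 2 → Bool),
      endWeight I a b F ((fun _ => e, z, x) : CoreState 1 N H) = f (e (Fin.last N))) :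
    ∑ e : Fin (N + 1) → Bool, coreWeight I a b F
      ((fun _ => e, fun k s => if s = 0 then τ k else v k, x) : CoreState 1 N H) =
    f true * opA (centralFermion a b) N τ v + f false * opB (centralFermion a b) N τ v := by
  simp only [coreWeight, hf, opA, opB, rowOp, Finset.mul_sum, ← Finset.sum_add_distrib]
  refine Finset.sum_congr rfl fun e _ => ?_
  simp only [Finset.univ_unique, Finset.prod_singleton]
  cases e 0 <;> cases e (Fin.last N) <;> simp [mul_comm]

lemma stateSum_central_of_no_half (D : R) (W : CoreState 1 N 0 → R) (τ β : Fin N → Bool)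
    (x : Fin 0 → Bool) :
    stateSum (p := 0) D Fin.elim0 W τ β = ∑ e : Fin (N + 1) → Bool,
      W (fun _ => e, fun k s => if s = 0 then τ k else β k, x) := by
  refine (stateSum_central D W τ β).trans ?_
  rw [Finset.sum_eq_single β]
  · rw [Finset.sum_eq_single x (fun y _ hy => absurd (Subsingleton.elim y x) hy)
      fun h => absurd (Finset.mem_univ x) h]
    exact if_pos (append_zero β x)
  · intro v _ hv
    rw [Fintype.sum_unique]
    exact if_neg fun h => hv ((append_zero v _).symm.trans h)
  · simp

lemma stateSum_center_B (D I a b : R) (N : ℕ) :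
    stateSum (p := 0) (c := 0) (N := N) (H := 0) D Fin.elim0 (coreWeight I a b .B) =
      (1 : Matrix (Fin N → Bool) (Fin N → Bool) R) := by
  ext τ β
  refine (stateSum_empty D _ τ β).trans ?_
  rw [Fintype.sum_unique, append_zero, Matrix.one_apply]
  simp [coreWeight, endWeight]

lemma stateSum_center_BStar (D I a b : R) (N : ℕ) :
    stateSum (p := 0) (c := 1) (N := N) (H := 0) D Fin.elim0 (coreWeight I a b .BStar) =
      opA (centralFermion a b) N := by
  ext τ β
  refine (stateSum_central_of_no_half D _ τ β Fin.elim0).trans ?_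
  rw [sum_coreWeight I a b .BStar τ β _ (fun y => if y = true then 1 else 0)]
  · simp
  · intro e z
    simp [endWeight]

lemma stateSum_center_BC (D I a b : R) (N : ℕ) :
    stateSum (p := 0) (c := 1) (N := N) (H := 0) D Fin.elim0 (coreWeight I a b .BC) =
      opB (centralFermion a b) N := by
  ext τ β
  refine (stateSum_central_of_no_half D _ τ β Fin.elim0).trans ?_
  rw [sum_coreWeight I a b .BC τ β _ (fun y => if y = false then 1 else 0)]
  · simp
  · intro e z
    simp [endWeight]

lemma stateSum_center_CStar (D I a b : R) (N : ℕ) :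
    stateSum (p := 0) (c := 0) (N := N) (H := 1) D Fin.elim0 (coreWeight I a b .CStar) =
      halfTop R N true := by
  ext τ β
  rw [stateSum_empty, sum_fin_one, append_one, append_one, halfTop]
  simp only [eq_comm (a := β)]
  simp [coreWeight, endWeight]

lemma stateSum_center_D (D I a b : R) (N : ℕ) :
    stateSum (p := 0) (c := 0) (N := N) (H := 1) D Fin.elim0 (coreWeight I a b .D) =
      halfTop R N false := by
  ext τ β
  rw [stateSum_empty, sum_fin_one, append_one, append_one, halfTop]
  simp only [eq_comm (a := β)]
  simp [coreWeight, endWeight]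

lemma stateSum_center_C (D I a b : R) (N : ℕ) :
    stateSum (p := 0) (c := 1) (N := N) (H := 1) D Fin.elim0 (coreWeight I a b .C) =
      cornerCenter I a b N := by
  ext τ β
  rw [stateSum_central, cornerCenter, Matrix.add_apply, Matrix.smul_apply, Matrix.mul_apply,
    Matrix.mul_apply, smul_eq_mul, Finset.mul_sum, ← Finset.sum_add_distrib]
  refine Finset.sum_congr rfl fun v _ => ?_
  rw [sum_fin_one, append_one, append_one,
    sum_coreWeight I a b .C τ v _ (fun y => if y = true then 1 else 0),
    sum_coreWeight I a b .C τ v _ (fun y => if y = false then a - I * b else 0)]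
  · simp [halfTop, eq_comm (a := β)]
  · intro e z
    cases h : e (Fin.last N) <;> simp [endWeight, h]
  · intro e z
    cases h : e (Fin.last N) <;> simp [endWeight, h]

/-- The part of a bent grid enclosed by all bends has the partition function `center`. -/
lemma stateSum_center (D I a b : R) (F : IceFamily) (N : ℕ) :
    stateSum (p := 0) (c := F.central) (H := F.half) D Fin.elim0 (coreWeight I a b F) =
      center I a b F N := by
  cases F
  · exact stateSum_center_B D I a b N
  · exact stateSum_center_BStar D I a b N
  · exact stateSum_center_C D I a b N
  · exact stateSum_center_CStar D I a b N
  · exact stateSum_center_D D I a b N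
  · exact stateSum_center_BC D I a b N

end Core

/-! ### The partition function in terms of transfer matrices -/

section Partition

variable {R : Type*} [CommRing R]

/-- The bent row with index `j`. -/
def bentRow (w : BoltzmannWeights R) (j : ℕ) : FermionRow R := ⟨w.a₁ j, w.a₂ j, w.b₁ j, w.b₂ j⟩

/-- The rows with indices `1, …, p`, from the outermost to the innermost one. -/
def bentRows (w : BoltzmannWeights R) (p : ℕ) : List (FermionRow R) :=
  List.ofFn fun j : Fin p => bentRow w (j + 1)

lemma bentRow_weights (w : BoltzmannWeights R) (j : ℕ) : (bentRow w j).weights = w.row j := rfl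

lemma bentRow_bar_weights (w : BoltzmannWeights R) (j : ℕ) :
    (bentRow w j).bar.weights = w.barRow j := by
  simp only [bentRow, FermionRow.bar, FermionRow.weights, BoltzmannWeights.barRow,
    BoltzmannWeights.row, SixVertexWeights.mk.injEq, true_and, and_true]
  ring

lemma centralFermion_weights (w : BoltzmannWeights R) (s : ℕ) :
    (centralFermion (w.a s) (w.b s)).weights = w.centralRow s := by
  simp [centralFermion, FermionRow.weights, BoltzmannWeights.centralRow, sq]

variable {K : Type*} [Field K] {p c N H : ℕ}

lemma isIce_of_weight_ne_zero {w : SixVertexWeights K} {v : VertexConfig} (h : w.weight v ≠ 0) :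
    v.IsIce := by
  obtain ⟨_ | _, _ | _, _ | _, _ | _⟩ := v <;>
    first | rfl | exact absurd rfl h

lemma stateFactor_eq (D : K) (u : Fin p → FermionRow K) (A : IceState p c N H) (j : Fin p) :
    stateFactor D u A j =
      if A.top j 0 = true ∧ A.bot j 0 = true ∧ A.bot j (Fin.last _) = !A.top j (Fin.last _) then
        (if A.top j (Fin.last _) = true then D else 1) *
          (∏ k, (u j).weights.weight (A.topVertex j k)) *
          ((∏ k, (u j).bar.weights.weight (A.botVertex j k)) *
            ∏ h, (u j).bar.weights.weight (A.halfVertex j h)) else 0 := by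
  rw [stateFactor, bentFactor, Fin.prod_univ_add]
  simp only [Fin.append_left, Fin.append_right]
  rfl

lemma rho_eq_colLabel {n : ℕ} {k : ℕ} (hk : k < n) :
    ∃ t, rho n t = IceFamily.colLabel (rho n) k := by
  have hsup : Finset.univ.sup (rho n) = n := by
    refine le_antisymm (Finset.sup_le fun t _ => Nat.sub_le _ _) ?_
    have := Finset.le_sup (f := rho n) (Finset.mem_univ ⟨0, by omega⟩)
    simpa [rho] using this
  exact ⟨⟨k, hk⟩, by simp [rho, IceFamily.colLabel, hsup]⟩

lemma fullCols_rho {n : ℕ} (hn : 1 ≤ n) (F : IceFamily) :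
    F.fullCols (rho n) = n + 1 - F.firstLabel := by
  have hsup : Finset.univ.sup (rho n) = n := by
    refine le_antisymm (Finset.sup_le fun t _ => Nat.sub_le _ _) ?_
    have := Finset.le_sup (f := rho n) (Finset.mem_univ ⟨0, by omega⟩)
    simpa [rho] using this
  rw [IceFamily.fullCols, hsup]

lemma rho_eq_one {n : ℕ} (hn : 1 ≤ n) : ∃ t, rho n t = 1 :=
  ⟨⟨n - 1, by omega⟩, by simp [rho]; omega⟩

open Classical in
/-- The boundary condition at the right end of the central row and at the top of the half column for
a partition containing the part `1`. -/
lemma endWeight_core {n : ℕ} (hn : 1 ≤ n) (I : K) (w : BoltzmannWeights K) (F : IceFamily)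
    (A : IceState p c N H) :
    endWeight I (w.a (F.star n)) (w.b (F.star n)) F (core A) =
      if A.RightEnd F (rho n) then cornerWeight I w F A else 0 := by
  cases F <;>
    simp [endWeight, core, IceState.RightEnd, cornerWeight, IceFamily.star, rho_eq_one hn] <;>
    congr

open Classical in
/-- The state sum runs over all assignments of arrows; the weight of an assignment which is not
admissible is zero. -/
lemma admissible_weight {n : ℕ} (hn : 1 ≤ n) (hN : N ≤ n) (I : K) (w : BoltzmannWeights K)
    (F : IceFamily) (A : IceState p c N H) :
    (if A.Admissible F (rho n) then stateWeight I w F (F.star n) A else 0) =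
      if topEdges A = allUp N ∧ bottomEdges A = allDown (N + H) then
        (∏ j, stateFactor (bendD I F) (fun j => bentRow w (j + 1)) A j) *
          coreWeight I (w.a (F.star n)) (w.b (F.star n)) F (core A) else 0 := by
  have hlab : ∀ k : Fin N, ∃ t, rho n t = IceFamily.colLabel (rho n) k := fun k =>
    rho_eq_colLabel (by omega)
  have htop : topEdges A = allUp N ↔ A.TopBoundary (rho n) := by
    simp only [IceState.TopBoundary, hlab, iff_true, funext_iff]
    rfl
  have hbot : bottomEdges A = allDown (N + H) ↔
      (∀ k, A.ver k (Fin.last _) = true) ∧ ∀ h, A.hver h (Fin.last _) = true := by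
    constructor
    · intro h
      refine ⟨fun k => ?_, fun k => ?_⟩
      · simpa [bottomEdges, allDown] using congrFun h (Fin.castAdd H k)
      · simpa [bottomEdges, allDown] using congrFun h (Fin.natAdd N k)
    · rintro ⟨h₁, h₂⟩
      funext k
      refine Fin.addCases (fun k => ?_) (fun k => ?_) k <;> simp [bottomEdges, allDown, h₁, h₂]
  have hcore : coreWeight I (w.a (F.star n)) (w.b (F.star n)) F (core A) =
      (∏ r, if A.mid r 0 = true then ∏ k, (w.centralRow (F.star n)).weight (A.midVertex r k) else 0)
        * if A.RightEnd F (rho n) then cornerWeight I w F A else 0 := by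
    rw [coreWeight, endWeight_core hn, centralFermion_weights]
    rfl
  rw [hcore]
  by_cases hA : A.Admissible F (rho n)
  · obtain ⟨⟨-, -, -, -, hbend⟩, ⟨hl₁, hl₂, hl₃, hb⟩, hr, ht⟩ := id hA
    rw [if_pos hA, if_pos ⟨htop.2 ht, hbot.2 hb⟩, if_pos hr]
    simp only [stateFactor_eq, hl₁, hl₂, hl₃, hbend, and_self, if_true, Finset.prod_mul_distrib,
      bentRow_weights, bentRow_bar_weights]
    simp only [stateWeight, bendWeight]
    ring
  · rw [if_neg hA]
    symm
    by_contra hne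
    apply hA
    split_ifs at hne with h₁ h₂
    · obtain ⟨h₃, h₄⟩ := mul_ne_zero_iff.1 hne
      obtain ⟨h₄, -⟩ := mul_ne_zero_iff.1 h₄
      rw [Finset.prod_ne_zero_iff] at h₃ h₄
      have hj : ∀ j : Fin p, (A.top j 0 = true ∧ A.bot j 0 = true ∧
          A.bot j (Fin.last _) = !A.top j (Fin.last _)) ∧
          (∀ k, (A.topVertex j k).IsIce) ∧ (∀ k, (A.botVertex j k).IsIce) ∧
          ∀ h, (A.halfVertex j h).IsIce := by
        intro j
        have h := h₃ j (Finset.mem_univ j)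
        rw [stateFactor_eq] at h
        split_ifs at h with hc <;> first | exact absurd rfl h | skip
        all_goals
          simp only [mul_ne_zero_iff, Finset.prod_ne_zero_iff] at h
          exact ⟨hc, fun k => isIce_of_weight_ne_zero (h.1.2 k (Finset.mem_univ k)),
            fun k => isIce_of_weight_ne_zero (h.2.1 k (Finset.mem_univ k)),
            fun k => isIce_of_weight_ne_zero (h.2.2 k (Finset.mem_univ k))⟩
      have hm : ∀ r : Fin c, A.mid r 0 = true ∧ ∀ k, (A.midVertex r k).IsIce := by
        intro r
        have h := h₄ r (Finset.mem_univ r)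
        split_ifs at h with hc
        · rw [Finset.prod_ne_zero_iff] at h
          exact ⟨hc, fun k => isIce_of_weight_ne_zero (h k (Finset.mem_univ k))⟩
        · exact absurd rfl h
      exact ⟨⟨fun j k => (hj j).2.1 k, fun r k => (hm r).2 k, fun j k => (hj j).2.2.1 k,
        fun j h => (hj j).2.2.2 h, fun j => (hj j).1.2.2⟩,
        ⟨fun j => (hj j).1.1, fun r => (hm r).1, fun j => (hj j).1.2.1, hbot.1 h₁.2⟩, h₂,
        htop.1 h₁.1⟩
    · simp at hne
    · exact absurd rfl hne

/-- The partition function for `ρ` in terms of transfer matrices. -/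
lemma partitionFunction_rho {n : ℕ} (hn : 1 ≤ n) (I : K) (w : BoltzmannWeights K)
    (F : IceFamily) {N : ℕ} (hN : n + 1 - F.firstLabel = N) :
    partitionFunction I w F (rho n) =
      bentGrid (bendD I F) (bentRows w (F.bends n))
        (center I (w.a (F.star n)) (w.b (F.star n)) F N) (allUp N) (allDown (N + F.half)) := by
  have hle : N ≤ n := by
    have : 1 ≤ F.firstLabel := by cases F <;> decide
    omega
  rw [bentRows, ← stateSum_center (bendD I F), ← stateSum_eq_bentGrid, stateSum, partitionFunction,
    Finset.sum_filter, fullCols_rho hn, hN]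
  exact Finset.sum_congr rfl fun A _ => admissible_weight hn hle I w F A

end Partition

/-! ### Change of the ring of weights -/

section Map

variable {R S : Type*} [CommRing R] [CommRing S] (f : R →+* S)

/-- The image of a row of weights under a ring homomorphism. -/
def FermionRow.map (u : FermionRow R) : FermionRow S := ⟨f u.a₁, f u.a₂, f u.b₁, f u.b₂⟩

lemma FermionRow.bar_map (u : FermionRow R) : (u.map f).bar = u.bar.map f := rfl

lemma FermionRow.alpha_map (u v : FermionRow R) : (u.map f).alpha (v.map f) = f (u.alpha v) := by
  simp [FermionRow.alpha, FermionRow.map]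

/-- The image of a system of Boltzmann weights under a ring homomorphism. -/
def mapWeights (w : BoltzmannWeights R) : BoltzmannWeights S where
  a₁ j := f (w.a₁ j)
  a₂ j := f (w.a₂ j)
  b₁ j := f (w.b₁ j)
  b₂ j := f (w.b₂ j)
  a j := f (w.a j)
  b j := f (w.b j)

lemma row_mapWeights (w : BoltzmannWeights R) (j : ℕ) (v : VertexConfig) :
    ((mapWeights f w).row j).weight v = f ((w.row j).weight v) := by
  obtain ⟨_ | _, _ | _, _ | _, _ | _⟩ := v <;>
    simp [SixVertexWeights.weight, BoltzmannWeights.row, mapWeights]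

lemma barRow_mapWeights (w : BoltzmannWeights R) (j : ℕ) (v : VertexConfig) :
    ((mapWeights f w).barRow j).weight v = f ((w.barRow j).weight v) := by
  obtain ⟨_ | _, _ | _, _ | _, _ | _⟩ := v <;>
    simp [SixVertexWeights.weight, BoltzmannWeights.barRow, BoltzmannWeights.row, mapWeights]

lemma centralRow_mapWeights (w : BoltzmannWeights R) (j : ℕ) (v : VertexConfig) :
    ((mapWeights f w).centralRow j).weight v = f ((w.centralRow j).weight v) := by
  obtain ⟨_ | _, _ | _, _ | _, _ | _⟩ := v <;>
    simp [SixVertexWeights.weight, BoltzmannWeights.centralRow, mapWeights]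

lemma partitionFunction_mapWeights (I : R) (w : BoltzmannWeights R) (F : IceFamily) {n : ℕ}
    (lam : Fin n → ℕ) :
    partitionFunction (f I) (mapWeights f w) F lam = f (partitionFunction I w F lam) := by
  have hb : bendD (f I) F = f (bendD I F) := by cases F <;> simp [bendD]
  simp only [partitionFunction, map_sum, stateWeight, map_mul, map_prod, row_mapWeights,
    barRow_mapWeights, centralRow_mapWeights]
  refine Finset.sum_congr rfl fun A _ => congrArg₂ _ (congrArg _ ?_) ?_
  · simp only [bendWeight, hb, apply_ite f, map_one]
  · cases F <;> simp [cornerWeight, mapWeights, apply_ite f]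

lemma linForm_map (q : R × R) (a b : R) :
    linForm (Prod.map f f q) (f a) (f b) = f (linForm q a b) := by
  simp [linForm]

lemma formProd_map (Q : List (R × R)) (a b : R) :
    formProd (Q.map (Prod.map f f)) (f a) (f b) = f (formProd Q a b) := by
  simp only [formProd, map_list_prod, List.map_map]
  exact congrArg _ (List.map_congr_left fun q _ => linForm_map f q a b)

lemma pairForms_map (l : List (FermionRow R)) :
    pairForms (l.map (FermionRow.map f)) = (pairForms l).map (Prod.map f f) := by
  simp [pairForms, List.map_flatMap, List.flatMap_map, FermionRow.map]

lemma gridProd_map (Q : List (R × R)) (l : List (FermionRow R)) :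
    gridProd (Q.map (Prod.map f f)) (l.map (FermionRow.map f)) = f (gridProd Q l) := by
  induction l with
  | nil => simp [gridProd]
  | cons w l ih =>
    rw [List.map_cons, gridProd, gridProd, ih, map_mul, ← formProd_map, pairForms_map,
      List.map_append]
    rfl

lemma specialForms_map (I a b : R) :
    specialForms (f I) (f a) (f b) = (specialForms I a b).map (Prod.map f f) := by
  simp [specialForms]

lemma familyForms_map (I a b : R) (F : IceFamily) :
    familyForms (f I) (f a) (f b) F = (familyForms I a b F).map (Prod.map f f) := by
  cases F <;> simp [familyForms]

variable {Q : List (R × R)} {l : List (FermionRow R)}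

/-- Non-degeneracy may be checked after a specialisation of the weights. -/
lemma Generic.of_map (h : Generic (Q.map (Prod.map f f)) (l.map (FermionRow.map f))) :
    Generic Q l := by
  have hf : ∀ {x : R}, f x ≠ 0 → x ≠ 0 := fun h e => h (by rw [e, map_zero])
  obtain ⟨h₁, h₂, h₃, h₄⟩ := h
  rw [pairForms_map, ← List.map_append] at h₁ h₂
  rw [List.pairwise_map] at h₂ h₄
  refine ⟨fun q hq => ?_, h₂.imp fun h => ?_, fun w hw q hq => ?_, h₄.imp fun h => ?_⟩
  · have := h₁ _ (List.mem_map_of_mem hq)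
    exact ⟨hf this.1, hf this.2⟩
  · intro e
    apply h
    simp only [Prod.map_fst, Prod.map_snd, ← map_mul, e]
  · have := h₃ _ (List.mem_map_of_mem hw) _ (List.mem_map_of_mem hq)
    exact hf ((linForm_map f q w.a₁ w.b₂).symm.trans_ne this)
  · simp only [FermionRow.bar_map, FermionRow.alpha_map] at h
    exact ⟨hf h.1, hf h.2.1, hf h.2.2⟩

lemma Generic.map (hf : Function.Injective f) (h : Generic Q l) :
    Generic (Q.map (Prod.map f f)) (l.map (FermionRow.map f)) := by
  have hf' : ∀ {x : R}, f x ≠ 0 ↔ x ≠ 0 := (map_ne_zero_iff f hf)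
  refine ⟨?_, ?_, ?_, ?_⟩
  · rw [pairForms_map, ← List.map_append]
    simp only [List.mem_map]
    rintro _ ⟨q, hq, rfl⟩
    exact ⟨hf'.2 (h.ne_zero q hq).1, hf'.2 (h.ne_zero q hq).2⟩
  · rw [pairForms_map, ← List.map_append, List.pairwise_map]
    refine h.indep.imp fun h e => h (hf ?_)
    simpa only [map_mul, Prod.map_fst, Prod.map_snd] using e
  · simp only [List.mem_map]
    rintro _ ⟨w, hw, rfl⟩ _ ⟨q, hq, rfl⟩
    exact (linForm_map f q w.a₁ w.b₂).trans_ne (hf'.2 (h.linForm_ne_zero w hw q hq))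
  · rw [List.pairwise_map]
    refine h.alpha_ne_zero.imp fun h => ?_
    simp only [FermionRow.bar_map, FermionRow.alpha_map]
    exact ⟨hf'.2 h.1, hf'.2 h.2.1, hf'.2 h.2.2⟩

end Map

/-! ### Indeterminate weights -/

section Evaluation

lemma bentRows_mapWeights {R S : Type*} [CommRing R] [CommRing S] (f : R →+* S)
    (w : BoltzmannWeights R) (p : ℕ) :
    bentRows (mapWeights f w) p = (bentRows w p).map (FermionRow.map f) := by
  rw [bentRows, bentRows, List.map_ofFn]
  rfl

/-- A numerical system of non-degenerate weights. The numbers `a₁`, `a₂` of the rows `j ≥ 1` are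
all distinct and at least `2`, so that with `b₁ = b₂ = 1` the slopes of all linear forms differ from
each other and from those of the forms `(1, i)`, `(1, -i)`, `(1, 1)`. -/
def sampleWeights : BoltzmannWeights GaussianInt where
  a₁ j := ((2 * j : ℕ) : GaussianInt)
  a₂ j := ((2 * j + 1 : ℕ) : GaussianInt)
  b₁ _ := 1
  b₂ _ := 1
  a _ := 1
  b _ := 1

lemma mem_pairForms_sampleWeights {p : ℕ} {q : GaussianInt × GaussianInt}
    (hq : q ∈ pairForms (bentRows sampleWeights p)) :
    ∃ m : ℕ, 2 ≤ m ∧ q = ((m : GaussianInt), 1) := by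
  simp only [pairForms, bentRows, List.mem_flatMap, List.mem_ofFn, List.mem_cons,
    List.not_mem_nil, or_false] at hq
  obtain ⟨_, ⟨j, rfl⟩, rfl | rfl⟩ := hq
  · exact ⟨2 * (j + 1), by omega, rfl⟩
  · exact ⟨2 * (j + 1) + 1, by omega, rfl⟩

lemma pairwise_pairForms_sampleWeights (p : ℕ) :
    (pairForms (bentRows sampleWeights p)).Pairwise Indep := by
  simp only [pairForms, List.pairwise_flatMap, bentRows, List.mem_ofFn, List.pairwise_ofFn]
  refine ⟨?_, fun i j hij => ?_⟩
  · rintro _ ⟨j, rfl⟩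
    simp only [List.pairwise_cons, List.mem_cons, List.not_mem_nil, or_false, forall_eq,
      IsEmpty.forall_iff, implies_true, List.Pairwise.nil, and_true, Indep, bentRow, sampleWeights,
      mul_one]
    norm_cast
    omega
  · have : i.val < j.val := hij
    simp only [List.mem_cons, List.not_mem_nil, or_false, forall_eq_or_imp, forall_eq, Indep,
      bentRow, sampleWeights, mul_one]
    norm_cast
    omega

lemma generic_sampleWeights (p : ℕ) :
    Generic (specialForms (⟨0, 1⟩ : GaussianInt) 1 1) (bentRows sampleWeights p) := by
  refine ⟨?_, ?_, ?_, ?_⟩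
  · intro q hq
    rcases List.mem_append.1 hq with hq | hq
    · simp only [specialForms, List.mem_cons, List.not_mem_nil, or_false] at hq
      rcases hq with rfl | rfl | rfl <;> decide
    · obtain ⟨m, hm, rfl⟩ := mem_pairForms_sampleWeights hq
      exact ⟨Nat.cast_ne_zero.2 (by omega), one_ne_zero⟩
  · refine List.pairwise_append.2 ⟨?_, pairwise_pairForms_sampleWeights p, ?_⟩
    · change List.Pairwise (fun q r : GaussianInt × GaussianInt => q.1 * r.2 ≠ r.1 * q.2) _
      decide
    · intro q hq r hr
      obtain ⟨m, hm, rfl⟩ := mem_pairForms_sampleWeights hr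
      simp only [specialForms, List.mem_cons, List.not_mem_nil, or_false] at hq
      rcases hq with rfl | rfl | rfl
      · intro e
        simpa using congrArg Zsqrtd.re e
      · intro e
        simpa using congrArg Zsqrtd.re e
      · simp only [Indep, mul_one]
        norm_cast
        omega
  · intro w hw q hq
    simp only [bentRows, List.mem_ofFn] at hw
    obtain ⟨j, rfl⟩ := hw
    simp only [specialForms, List.mem_cons, List.not_mem_nil, or_false] at hq
    rcases hq with rfl | rfl | rfl
    · intro e
      simpa [linForm, bentRow, sampleWeights] using congrArg Zsqrtd.im e
    · intro e
      simpa [linForm, bentRow, sampleWeights] using congrArg Zsqrtd.im e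
    · simp only [linForm, bentRow, sampleWeights, mul_one, one_mul]
      norm_cast
  · simp only [bentRows, List.pairwise_ofFn]
    intro i j _
    simp only [FermionRow.alpha, FermionRow.bar, bentRow, sampleWeights, mul_one]
    norm_cast

/-- The specialisation of the indeterminates to `sampleWeights`. -/
noncomputable def evalSample : WeightRing →+* GaussianInt :=
  MvPolynomial.eval₂Hom (RingHom.id _) fun
    | .a₁ j => sampleWeights.a₁ j
    | .a₂ j => sampleWeights.a₂ j
    | .b₁ j => sampleWeights.b₁ j
    | .b₂ j => sampleWeights.b₂ j
    | .a j => sampleWeights.a j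
    | .b j => sampleWeights.b j

lemma mapWeights_evalSample : mapWeights evalSample gen = sampleWeights := by
  simp [mapWeights, evalSample, gen, sampleWeights]

lemma generic_gen (p s : ℕ) :
    Generic (specialForms imUnit (gen.a s) (gen.b s)) (bentRows gen p) := by
  have ha : evalSample (gen.a s) = 1 :=
    congrFun (congrArg BoltzmannWeights.a mapWeights_evalSample) s
  have hb : evalSample (gen.b s) = 1 :=
    congrFun (congrArg BoltzmannWeights.b mapWeights_evalSample) s
  have hI : evalSample imUnit = ⟨0, 1⟩ := by simp [evalSample, imUnit]
  apply Generic.of_map evalSample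
  rw [← specialForms_map, ← bentRows_mapWeights, mapWeights_evalSample, ha, hb, hI]
  exact generic_sampleWeights p

lemma imUnit_mul_imUnit : imUnit * imUnit = -1 := by
  rw [imUnit, ← map_mul, ← MvPolynomial.C_1, ← map_neg]
  exact congrArg _ (by decide)

/-- The partition function of the indeterminate weights as a product of linear forms. The identity
is proved in the field of fractions. -/
lemma genericZ_rho {n : ℕ} (hn : 1 ≤ n) (F : IceFamily) :
    genericZ F (rho n) = gridProd (familyForms imUnit (gen.a (F.star n)) (gen.b (F.star n)) F)
      (bentRows gen (F.bends n)) := by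
  let f : WeightRing →+* FractionRing WeightRing := algebraMap _ _
  have hf : Function.Injective f := IsFractionRing.injective _ _
  apply hf
  have hI : f imUnit * f imUnit = -1 := by
    rw [← map_mul, imUnit_mul_imUnit, map_neg, map_one]
  have hgen := (generic_gen (F.bends n) (F.star n)).map f hf
  rw [← specialForms_map, ← bentRows_mapWeights] at hgen
  rw [genericZ, ← partitionFunction_mapWeights, partitionFunction_rho hn _ _ F rfl,
    ← gridProd_map, ← familyForms_map, ← bentRows_mapWeights]
  refine bentGrid_center hI _ _ F _ _ hgen ?_
  rw [bentRows, List.length_ofFn]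
  cases F <;> simp [IceFamily.half, IceFamily.firstLabel, familyForms, IceFamily.bends] <;> omega

end Evaluation

/-! ### Products over the rows -/

section Products

variable {R : Type*} [CommRing R]

lemma formProd_pairForms (l : List (FermionRow R)) (a b : R) :
    formProd (pairForms l) a b =
      (l.map fun v => (v.a₁ * a + v.b₂ * b) * (v.a₂ * a + v.b₁ * b)).prod := by
  induction l with
  | nil => rfl
  | cons v l ih =>
    rw [pairForms_cons, formProd_append, ih, List.map_cons, List.prod_cons]
    simp [formProd, linForm]

lemma prod_map_ofFn_bentRow (w : BoltzmannWeights R)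
    (g : FermionRow R → R) (m p : ℕ) :
    ((List.ofFn fun j : Fin p => bentRow w (m + j + 1)).map g).prod =
      ∏ k ∈ Finset.Ioc m (m + p), g (bentRow w k) := by
  rw [List.map_ofFn, List.prod_ofFn, ← Finset.Icc_succ_left_eq_Ioc, ← Finset.Ico_succ_right_eq_Icc,
    Finset.prod_Ico_eq_prod_range]
  simp only [Order.succ_eq_add_one, show m + p + 1 - (m + 1) = p by omega]
  rw [← Fin.prod_univ_eq_prod_range]
  refine Finset.prod_congr rfl fun j _ => ?_
  rw [Function.comp_apply, show m + 1 + j.val = m + j + 1 by omega]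

lemma gridProd_ofFn_bentRow (w : BoltzmannWeights R) (Q : List (R × R)) (m p : ℕ) :
    gridProd Q (List.ofFn fun j : Fin p => bentRow w (m + j + 1)) =
      ∏ j ∈ Finset.Ioc m (m + p), (formProd Q (w.a₂ j) (w.b₁ j) *
        ∏ k ∈ Finset.Ioc j (m + p), ((w.a₁ k * w.a₂ j + w.b₂ k * w.b₁ j) *
          (w.a₂ k * w.a₂ j + w.b₁ k * w.b₁ j))) := by
  induction p generalizing m with
  | zero => simp [gridProd]
  | succ p ih =>
    have h : (List.ofFn fun j : Fin (p + 1) => bentRow w (m + j + 1)) =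
        bentRow w (m + 1) :: List.ofFn fun j : Fin p => bentRow w (m + 1 + j + 1) := by
      rw [List.ofFn_succ]
      simp [Nat.add_right_comm, Nat.add_assoc, Nat.add_comm 1]
    rw [h, gridProd, ih, formProd_append, formProd_pairForms, prod_map_ofFn_bentRow,
      show m + (p + 1) = m + 1 + p by omega]
    rw [← Finset.insert_Ioc_add_one_left_eq_Ioc (show m < m + 1 + p by omega),
      Finset.prod_insert (by simp)]
    rfl

lemma gridProd_bentRows (w : BoltzmannWeights R) (Q : List (R × R)) (p : ℕ) :
    gridProd Q (bentRows w p) =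
      (∏ j ∈ Finset.Icc 1 p, formProd Q (w.a₂ j) (w.b₁ j)) *
        ∏ j ∈ Finset.Icc 1 p, ∏ k ∈ Finset.Ioc j p,
          ((w.a₁ k * w.a₂ j + w.b₁ j * w.b₂ k) * (w.a₂ j * w.a₂ k + w.b₁ k * w.b₁ j)) := by
  have h := gridProd_ofFn_bentRow w Q 0 p
  simp only [Nat.zero_add] at h
  rw [bentRows, h, ← Finset.prod_mul_distrib]
  refine Finset.prod_congr rfl fun j _ => congrArg _ (Finset.prod_congr rfl fun k _ => ?_)
  ring

end Products

/-! ### Homogeneity of the factors -/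

section Homogeneous

open MvPolynomial

lemma isHomogeneous_gen_mul (x y z t : WeightVar) :
    (X x * X y + X z * X t : WeightRing).IsHomogeneous 2 :=
  ((isHomogeneous_X _ x).mul (isHomogeneous_X _ y)).add
    ((isHomogeneous_X _ z).mul (isHomogeneous_X _ t))

lemma isHomogeneous_gen_add (x y : WeightVar) (c : GaussianInt) :
    (X x + C c * X y : WeightRing).IsHomogeneous 1 :=
  (isHomogeneous_X _ x).add ((isHomogeneous_C_mul_X c y))

lemma formProd_familyForms_mem (s j : ℕ) (F : IceFamily) :
    formProd (familyForms imUnit (gen.a s) (gen.b s) F) (gen.a₂ j) (gen.b₁ j) ∈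
      Submonoid.closure {f : WeightRing | f.IsHomogeneous 1 ∨ f.IsHomogeneous 2} := by
  refine Submonoid.list_prod_mem _ fun f hf => Submonoid.subset_closure ?_
  obtain ⟨q, hq, rfl⟩ := List.mem_map.1 hf
  have h := (familyForms_sublist _ _ _ F).subset hq
  simp only [specialForms, List.mem_cons, List.not_mem_nil, or_false] at h
  rcases h with rfl | rfl | rfl
  · refine Or.inl ?_
    rw [linForm, one_mul]
    exact isHomogeneous_gen_add _ _ _
  · refine Or.inl ?_
    rw [linForm, one_mul, imUnit, ← map_neg]
    exact isHomogeneous_gen_add _ _ _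
  · exact Or.inr (isHomogeneous_gen_mul _ _ _ _)

lemma genericZ_rho_mem {n : ℕ} (hn : 1 ≤ n) (F : IceFamily) :
    genericZ F (rho n) ∈
      Submonoid.closure {f : WeightRing | f.IsHomogeneous 1 ∨ f.IsHomogeneous 2} := by
  rw [genericZ_rho hn, gridProd_bentRows]
  refine mul_mem (prod_mem fun j _ => formProd_familyForms_mem _ _ F)
    (prod_mem fun j _ => prod_mem fun k _ => mul_mem ?_ ?_) <;>
  exact Submonoid.subset_closure (Or.inr (isHomogeneous_gen_mul _ _ _ _))

end Homogeneous

lemma linForm_imUnit_mul (x y : WeightRing) :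
    linForm (1, imUnit) x y * linForm (1, -imUnit) x y = x ^ 2 + y ^ 2 := by
  simp only [linForm]
  linear_combination -y ^ 2 * imUnit_mul_imUnit

end BentIce

open BentIce

theorem mainTheorem2 (n : ℕ) (hn : 1 ≤ n) :
    (genericZ .B (rho n) =
      (∏ j ∈ Finset.Icc 1 n, (gen.a₂ j + imUnit * gen.b₁ j)) *
      ∏ j ∈ Finset.Icc 1 n, ∏ k ∈ Finset.Ioc j n,
        ((gen.a₁ k * gen.a₂ j + gen.b₁ j * gen.b₂ k) *
          (gen.a₂ j * gen.a₂ k + gen.b₁ k * gen.b₁ j))) ∧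
    (genericZ .BStar (rho n) =
      (∏ j ∈ Finset.Icc 1 n, (gen.a 0 * gen.a₂ j + gen.b₁ j * gen.b 0)) *
      ∏ j ∈ Finset.Icc 1 n, ∏ k ∈ Finset.Ioc j n,
        ((gen.a₁ k * gen.a₂ j + gen.b₁ j * gen.b₂ k) *
          (gen.a₂ j * gen.a₂ k + gen.b₁ k * gen.b₁ j))) ∧
    (genericZ .C (rho n) =
      (∏ j ∈ Finset.Icc 1 n,
        ((gen.a₂ j + imUnit * gen.b₁ j) * (gen.a 0 * gen.a₂ j + gen.b₁ j * gen.b 0))) *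
      ∏ j ∈ Finset.Icc 1 n, ∏ k ∈ Finset.Ioc j n,
        ((gen.a₁ k * gen.a₂ j + gen.b₁ j * gen.b₂ k) *
          (gen.a₂ j * gen.a₂ k + gen.b₁ k * gen.b₁ j))) ∧
    (genericZ .CStar (rho n) =
      (∏ j ∈ Finset.Icc 1 n, (gen.a₂ j ^ 2 + gen.b₁ j ^ 2)) *
      ∏ j ∈ Finset.Icc 1 n, ∏ k ∈ Finset.Ioc j n,
        ((gen.a₁ k * gen.a₂ j + gen.b₁ j * gen.b₂ k) *
          (gen.a₂ j * gen.a₂ k + gen.b₁ k * gen.b₁ j))) ∧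
    (genericZ .D (rho n) =
      ∏ j ∈ Finset.Icc 1 n, ∏ k ∈ Finset.Ioc j n,
        ((gen.a₁ k * gen.a₂ j + gen.b₁ j * gen.b₂ k) *
          (gen.a₂ j * gen.a₂ k + gen.b₁ k * gen.b₁ j))) ∧
    (genericZ .BC (rho n) =
      (∏ j ∈ Finset.Icc 1 (n - 1),
        ((gen.a n * gen.a₂ j + gen.b₁ j * gen.b n) * (gen.a₂ j ^ 2 + gen.b₁ j ^ 2))) *
      ∏ j ∈ Finset.Icc 1 (n - 1), ∏ k ∈ Finset.Ioc j (n - 1),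
        ((gen.a₁ k * gen.a₂ j + gen.b₁ j * gen.b₂ k) *
          (gen.a₂ j * gen.a₂ k + gen.b₁ k * gen.b₁ j))) ∧
    (∀ M : IceFamily, ∃ s : Multiset WeightRing,
      (∀ f ∈ s, f.IsHomogeneous 1 ∨ f.IsHomogeneous 2) ∧ genericZ M (rho n) = s.prod) := by
  refine ⟨?_, ?_, ?_, ?_, ?_, ?_, fun M => ?_⟩
  · rw [genericZ_rho hn, gridProd_bentRows]
    simp [familyForms, formProd, linForm, IceFamily.bends]
  · rw [genericZ_rho hn, gridProd_bentRows]
    simp [familyForms, formProd, linForm, IceFamily.bends, IceFamily.star, mul_comm (gen.b 0)]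
  · rw [genericZ_rho hn, gridProd_bentRows]
    simp [familyForms, formProd, linForm, IceFamily.bends, IceFamily.star, mul_comm (gen.b 0)]
  · rw [genericZ_rho hn, gridProd_bentRows]
    simp [familyForms, formProd, linForm_imUnit_mul, IceFamily.bends]
  · rw [genericZ_rho hn, gridProd_bentRows]
    simp [familyForms, formProd, IceFamily.bends]
  · rw [genericZ_rho hn, gridProd_bentRows]
    simp only [IceFamily.bends, familyForms, formProd, List.map_cons, List.map_nil, List.prod_cons,
      List.prod_nil, mul_one, IceFamily.star, linForm_imUnit_mul, ← mul_assoc (linForm _ _ _)]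
    simp only [linForm, mul_comm (gen.b n), mul_comm (_ ^ 2 + _)]
  · obtain ⟨s, hs, h⟩ := Submonoid.exists_multiset_of_mem_closure (genericZ_rho_mem hn M)
    exact ⟨s, hs, h.symm⟩
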